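/- For a finitely generated subgroup $\Gamma\subseteq\mathbb{Q}^*$ and an integer $k\ge 1$, let $\mathbb{Q}(\zeta_k,\Gamma^{1/k})\subset\mathbb{C}$ be the field generated over $\mathbb{Q}$ by a primitive $k$-th root of unity $\zeta_k$ and all $k$-th roots of all elements of $\Gamma$. Let $J_t(k)=k^t\prod_{\ell\mid k}(1-\ell^{-t})$ ($\ell$ prime) be Jordan's totient function, $\operatorname{rad}(k)$ the product of the distinct primes dividing $k$, and $\omega(k)$ the number of these primes. Put $$C_{\Gamma,t}=\sum_{k\ge1}\frac{J_t(k)\,\operatorname{rad}(k)^t\,(-1)^{\omega(k)}}{k^{2t}\,[\mathbb{Q}(\zeta_k,\Gamma^{1/k}):\mathbb{Q}]},\qquad C_\Gamma=C_{\Gamma,1}.$$ For $\eta\in\mathbb{Q}^*$ let $\delta(\eta)$ be the discriminant of the number field $\mathbb{Q}(\sqrt{\eta})$, and let $v_2$ denote the $2$-adic valuation on $\mathbb{Q}^*$. Let $r\ge1$, let $p_1,\dots,p_r$ be distinct prime numbers, and let $\Gamma=\langle p_1,\dots,p_r\rangle\subset\mathbb{Q}^*$. Then the series defining $C_\Gamma$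 converges absolutely, the product over all primes $p$ below converges unconditionally, and $$C_\Gamma=\prod_{p}\left(1-\frac{p}{p^{r+2}-1}\right)\cdot\left(1+\sum_{\substack{\eta\mid p_1\cdots p_r\\ \eta\ne1}}\frac{1}{2^{\max\{0,\,v_2(\delta(\eta)/2)\}(r+2)}}\prod_{\ell\mid 2\eta}\frac{\ell}{\ell+1-\ell^{r+2}}\right),$$ where $\eta$ runs over the positive divisors of $p_1\cdots p_r$ other than $1$ and $\ell$ over the primes dividing $2\eta$. -/

import Mathlib

noncomputable section

/-- The field `ℚ(ζ_k, Γ^{1/k})` inside `ℂ`: the extension of `ℚ` obtained by adjoining the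
primitive `k`-th roots of unity and all `k`-th roots of all elements of `Γ`. -/
def kummerField (Γ : Subgroup ℚˣ) (k : ℕ) : IntermediateField ℚ ℂ :=
  IntermediateField.adjoin ℚ
    ({z : ℂ | IsPrimitiveRoot z k} ∪ {z : ℂ | ∃ g ∈ Γ, z ^ k = ((g : ℚ) : ℂ)})

/-- Jordan's totient function `J_t(m) = m^t ∏_{ℓ ∣ m} (1 - 1/ℓ^t)`. -/
def jordanTotient (t m : ℕ) : ℝ :=
  (m : ℝ) ^ t * ∏ l ∈ m.primeFactors, (1 - 1 / (l : ℝ) ^ t)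

/-- The `k`-th term of the series defining `C_{Γ,t}`. -/
def densityTerm (Γ : Subgroup ℚˣ) (t k : ℕ) : ℝ :=
  jordanTotient t k * ((UniqueFactorizationMonoid.radical k : ℕ) : ℝ) ^ t *
      (-1) ^ (ArithmeticFunction.cardDistinctFactors k) /
    ((k : ℝ) ^ (2 * t) * (Module.finrank ℚ (kummerField Γ k) : ℝ))

/-- The constant `C_{Γ,t}`, a series over the positive integers `k`. -/
def densityConst (Γ : Subgroup ℚˣ) (t : ℕ) : ℝ :=
  ∑' k : ℕ+, densityTerm Γ t k

/-- The field `ℚ(√η)` inside `ℂ`. -/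
def quadField (η : ℚ) : IntermediateField ℚ ℂ :=
  IntermediateField.adjoin ℚ {z : ℂ | z ^ 2 = (η : ℂ)}

instance quadField_numberField (η : ℚ) : NumberField (quadField η) where
  to_charZero := inferInstance
  to_finiteDimensional := by
    have hfin : Set.Finite {z : ℂ | z ^ 2 = (η : ℂ)} := by
      have h := (Polynomial.nthRoots 2 (η : ℂ)).toFinset.finite_toSet
      refine h.subset fun z hz => ?_
      simpa [Polynomial.mem_nthRoots] using hz
    have : Finite {z : ℂ | z ^ 2 = (η : ℂ)} := hfin
    refine IntermediateField.finiteDimensional_adjoin fun z hz => ?_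
    refine IsIntegral.of_pow (n := 2) (by norm_num) ?_
    rw [Set.mem_ofPred_eq.mp hz]
    exact isIntegral_algebraMap (R := ℚ) (A := ℂ) (x := η)

/-- `δ(η)`, the discriminant of the number field `ℚ(√η)`. -/
def quadDiscr (η : ℚ) : ℤ := NumberField.discr (quadField η)

end

noncomputable section

/-! The core is an exact degree formula. Over `ℚ(ζ_k)` the field is a Kummer extension generated by
the real numbers `∏ pᵢ^{eᵢ/k}`, so its relative degree is the index in `ℤ^r` of the group `H` of
exponents whose root already lies in `ℚ(ζ_k)` (`finrank_adjoin_range_eq_index`). Since `ℚ(ζ_k)` is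
abelian, such a root has a rational square (`exists_rat_eq_sq_of_mem_cycField`), which forces `k ∣
2eᵢ`. Modulo `k`, the elements of `H` thus have entries `0` or `k/2` and correspond to the square
roots `√η ∈ ℚ(ζ_k)` with `η ∣ p₁⋯p_r`. For even `k` and `η ≠ 1` the condition is `δ(η) ∣ k`. Hence
the degree is `φ(k) k^r` divided by one plus the number of `η ≠ 1` with `lcm(2, δ(η)) ∣ k`
(`finrank_kummerField_mul`).

As `J₁ = φ`, the `k`-th term is `radicalTerm (r + 2) k` times that count. After interchanging sums,
each `η` contributes the sum of a multiplicative function over the multiples of `D = lcm(2, δ(η))`: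
the full Euler product with the factor at each `p ∣ D` replaced by a tail (`tsum_ite_dvd_eq`).
Geometric series give the stated ratios, and the power of `2` records the exponent of `2` in `D`. -/

/-! ### Euler products restricted by divisibility conditions -/

open Finset in
/-- Multiplying a multiplicative function by truncations at finitely many primes changes finitely
many Euler factors. -/
theorem tsum_mul_truncation_eq {f : ℕ → ℝ} (hf₁ : f 1 = 1) (hf₀ : f 0 = 0)
    (hmul : ∀ {m n : ℕ}, m.Coprime n → f (m * n) = f m * f n) (hsum : Summable (‖f ·‖))
    (v : ℕ → ℕ) (T : Finset ℕ) (hT : ∀ p ∈ T, p.Prime) (hv : ∀ p ∈ T, 0 < v p)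
    (hE : ∀ p ∈ T, ∑' e, f (p ^ e) ≠ 0) :
    Summable (fun k => f k * ∏ p ∈ T, if k.factorization p < v p then (1 : ℝ) else 0) ∧
    ∑' k, f k * ∏ p ∈ T, (if k.factorization p < v p then (1 : ℝ) else 0) =
      (∑' k, f k) * ∏ p ∈ T, (∑ e ∈ range (v p), f (p ^ e)) / ∑' e, f (p ^ e) := by
  set w : ℕ → ℝ := fun k => ∏ p ∈ T, if k.factorization p < v p then (1 : ℝ) else 0 with hw
  have hw1 : ∀ k, ‖w k‖ ≤ 1 := by
    intro k
    rw [hw]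
    simp only [norm_prod]
    refine prod_le_one (fun _ _ => norm_nonneg _) fun p _ => ?_
    split_ifs <;> simp
  have hsum' : Summable (fun k => ‖f k * w k‖) := by
    refine Summable.of_nonneg_of_le (fun _ => norm_nonneg _) (fun k => ?_) hsum
    rw [norm_mul]
    exact mul_le_of_le_one_right (norm_nonneg _) (hw1 k)
  refine ⟨hsum'.of_norm, ?_⟩
  have hwmul : ∀ {m n : ℕ}, m.Coprime n → w (m * n) = w m * w n := by
    intro m n h
    simp only [hw, ← prod_mul_distrib]
    refine prod_congr rfl fun p hp => ?_
    have hvp := hv p hp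
    rw [Nat.factorization_mul_of_coprime h, Finsupp.add_apply]
    have : m.factorization p = 0 ∨ n.factorization p = 0 := by
      by_contra! hcon
      have h1 := Nat.dvd_of_factorization_pos hcon.1
      have h2 := Nat.dvd_of_factorization_pos hcon.2
      exact (hT p hp).one_lt.ne' (Nat.eq_one_of_dvd_coprimes h h1 h2)
    rcases this with h | h <;> simp [h, hvp]
  have hprod := EulerProduct.eulerProduct_hasProd (f := fun k => f k * w k)
    (by simp only [hf₁, hw]
        rw [one_mul]
        exact prod_eq_one fun p hp => by simp [hv p hp])
    (fun {m n} h => by simp only [hmul h, hwmul h]; ring) hsum' (by simp [hf₀])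
  have hE0 := EulerProduct.eulerProduct_hasProd hf₁ hmul hsum hf₀
  -- The ratio of truncated to full Euler factor, equal to 1 off `T`; multiplying it into the Euler
  -- product of `f` gives that of `f * w`.
  obtain ⟨g, hg⟩ : ∃ g : ℕ → ℝ, g = fun q => if q ∈ T then
      (∑ e ∈ range (v q), f (q ^ e)) / ∑' e, f (q ^ e) else 1 := ⟨_, rfl⟩
  have hfin : HasProd (fun q : Nat.Primes => g q)
      (∏ p ∈ T, (∑ e ∈ range (v p), f (p ^ e)) / ∑' e, f (p ^ e)) := by
    have h : HasProd g (∏ p ∈ T, g p) := hasProd_prod_of_ne_finset_one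
      (L := SummationFilter.unconditional ℕ) (fun b hb => by rw [hg]; exact if_neg hb)
    rw [prod_congr rfl (g := fun p => (∑ e ∈ range (v p), f (p ^ e)) / ∑' e, f (p ^ e))
      (fun p hp => by rw [hg]; exact if_pos hp)] at h
    refine (hasProd_subtype_iff_of_mulSupport_subset (s := {q : ℕ | q.Prime}) ?_).mpr h
    intro x hx
    by_contra hcon
    refine hx ?_
    rw [hg]
    exact if_neg fun hxT => hcon (hT x hxT)
  refine hprod.unique ?_
  convert! hE0.mul hfin using 2 with q
  have hloc : ∀ e, w ((q : ℕ) ^ e) = if (q : ℕ) ∈ T then (if e < v q then 1 else 0) else 1 := by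
    intro e
    simp only [hw, q.2.factorization_pow]
    split_ifs with h1 h2
    · refine prod_eq_one fun p hp => ?_
      by_cases hpq : p = q
      · subst hpq; simp [h2]
      · simp [Ne.symm hpq, hv p hp]
    · exact prod_eq_zero h1 (by simp [h2])
    · refine prod_eq_one fun p hp => ?_
      have hpq : p ≠ q := fun h => h1 (h ▸ hp)
      simp [Ne.symm hpq, hv p hp]
  simp only [hloc, hg]
  split_ifs with h
  · rw [mul_div_cancel₀ _ (hE q h), tsum_eq_sum (s := range (v q))]
    · exact sum_congr rfl fun e he => by rw [if_pos (mem_range.mp he), mul_one]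
    · intro e he
      rw [if_neg (by simpa using he), mul_zero]
  · simp

-- Inclusion–exclusion: the indicator of `D ∣ k` is the product over `p ∣ D` of `1 - [v_p(k) <
-- v_p(D)]`. Each term of its expansion is a truncation at a set of primes, and the evaluated terms
-- recombine into one product.
open Finset in
theorem tsum_ite_dvd_eq {f : ℕ → ℝ} (hf₁ : f 1 = 1) (hf₀ : f 0 = 0)
    (hmul : ∀ {m n : ℕ}, m.Coprime n → f (m * n) = f m * f n) (hsum : Summable (‖f ·‖))
    {D : ℕ} (hD : D ≠ 0) (hE : ∀ p ∈ D.primeFactors, ∑' e, f (p ^ e) ≠ 0) :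
    ∑' k, (if D ∣ k then f k else 0) = (∑' k, f k) *
      ∏ p ∈ D.primeFactors,
        (1 - (∑ e ∈ range (D.factorization p), f (p ^ e)) / ∑' e, f (p ^ e)) := by
  have hT : ∀ T ∈ D.primeFactors.powerset, _ := fun T hT =>
    have hTD := mem_powerset.mp hT
    tsum_mul_truncation_eq hf₁ hf₀ hmul hsum D.factorization T
      (fun p hp => Nat.prime_of_mem_primeFactors (hTD hp))
      (fun p hp => by
        have := hTD hp
        rw [← Nat.support_factorization, Finsupp.mem_support_iff] at this
        omega)
      (fun p hp => hE p (hTD hp))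
  have hpt : ∀ k, (if D ∣ k then f k else 0) = ∑ T ∈ D.primeFactors.powerset, (-1) ^ #T *
      (f k * ∏ p ∈ T, if k.factorization p < D.factorization p then (1 : ℝ) else 0) := by
    intro k
    have h1 : ∀ T : Finset ℕ, (-1) ^ #T *
        (f k * ∏ p ∈ T, if k.factorization p < D.factorization p then (1 : ℝ) else 0) =
        f k * ∏ p ∈ T, -(if k.factorization p < D.factorization p then (1 : ℝ) else 0) := by
      intro T
      rw [prod_neg]
      ring
    simp_rw [h1, ← mul_sum, ← prod_one_add]
    rcases eq_or_ne k 0 with rfl | hk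
    · simp [hf₀]
    split_ifs with h
    · rw [prod_eq_one, mul_one]
      intro p _
      have := (Nat.factorization_le_iff_dvd hD hk).mpr h p
      simp [this.not_gt]
    · symm
      rw [← Nat.factorization_prime_le_iff_dvd hD hk] at h
      push Not at h
      obtain ⟨p, hp, hlt⟩ := h
      rw [prod_eq_zero (i := p), mul_zero]
      · rw [← Nat.support_factorization, Finsupp.mem_support_iff]
        omega
      · simp [hlt]
  simp_rw [hpt]
  rw [Summable.tsum_finsetSum fun T h => (hT T h).1.mul_left _]
  simp_rw [tsum_mul_left]
  rw [sum_congr rfl fun T h => by rw [(hT T h).2]]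
  simp_rw [sub_eq_add_neg, prod_one_add, mul_sum, prod_neg]
  exact sum_congr rfl fun _ _ => by ring

/-! ### Euler factors of the main multiplicative function -/

/-- The multiplicative function `rad(k) (-1)^{ω(k)} / k^s`. -/
def radicalTerm (s k : ℕ) : ℝ :=
  ((UniqueFactorizationMonoid.radical k : ℕ) : ℝ) *
    (-1) ^ (ArithmeticFunction.cardDistinctFactors k) / (k : ℝ) ^ s

theorem radicalTerm_one (s : ℕ) : radicalTerm s 1 = 1 := by
  simp [radicalTerm]

theorem radicalTerm_zero {s : ℕ} (hs : s ≠ 0) : radicalTerm s 0 = 0 := by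
  simp [radicalTerm, hs]

theorem radicalTerm_mul (s : ℕ) {m n : ℕ} (h : m.Coprime n) :
    radicalTerm s (m * n) = radicalTerm s m * radicalTerm s n := by
  rw [radicalTerm, UniqueFactorizationMonoid.radical_mul (Nat.coprime_iff_isRelPrime.mp h),
    ArithmeticFunction.cardDistinctFactors_mul h, radicalTerm, radicalTerm]
  push_cast
  rw [mul_pow, pow_add]
  field_simp

theorem norm_radicalTerm_le {s : ℕ} (hs : 3 ≤ s) (k : ℕ) :
    ‖radicalTerm s k‖ ≤ 1 / (k : ℝ) ^ 2 := by
  rcases eq_or_ne k 0 with rfl | hk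
  · simp [radicalTerm_zero (s := s) (by omega)]
  have h1 : (1 : ℝ) ≤ k := by exact_mod_cast Nat.one_le_iff_ne_zero.mpr hk
  rw [radicalTerm, norm_div, norm_mul]
  simp only [norm_pow, norm_neg, norm_one, one_pow, mul_one, Real.norm_natCast]
  rw [div_le_div_iff₀ (by positivity) (by positivity), one_mul]
  have h2 : ((UniqueFactorizationMonoid.radical k : ℕ) : ℝ) ≤ k := by
    exact_mod_cast Nat.le_of_dvd (by omega) UniqueFactorizationMonoid.radical_dvd_self
  calc _ ≤ (k : ℝ) * k ^ 2 := by gcongr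
    _ = (k : ℝ) ^ 3 := by ring
    _ ≤ _ := pow_le_pow_right₀ h1 hs

theorem summable_norm_radicalTerm {s : ℕ} (hs : 3 ≤ s) :
    Summable (fun k => ‖radicalTerm s k‖) :=
  Summable.of_nonneg_of_le (fun _ => norm_nonneg _) (norm_radicalTerm_le hs)
    (Real.summable_one_div_nat_pow.mpr one_lt_two)

theorem radicalTerm_prime_pow (s : ℕ) {p : ℕ} (hp : p.Prime) (e : ℕ) :
    radicalTerm s (p ^ (e + 1)) = -(p : ℝ) / (p : ℝ) ^ s * (1 / (p : ℝ) ^ s) ^ e := by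
  rw [radicalTerm, UniqueFactorizationMonoid.radical_pow_of_prime hp.prime (by omega),
    ArithmeticFunction.cardDistinctFactors_apply_prime_pow hp (by omega)]
  have : (p : ℝ) ≠ 0 := by exact_mod_cast hp.ne_zero
  simp
  field_simp
  ring

/-- Geometric tail of the Euler factor at `p`: `v = 0` yields the full factor apart from its term 1,
general `v` the part with `p ^ (v + 1) ∣ k`. -/
theorem hasSum_radicalTerm_prime_pow {s : ℕ} (hs : 3 ≤ s) {p : ℕ} (hp : p.Prime) (v : ℕ) :
    HasSum (fun e => radicalTerm s (p ^ (e + v + 1)))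
      (-(1 / (p : ℝ) ^ (v * s) * ((p : ℝ) / ((p : ℝ) ^ s - 1)))) := by
  have hp1 : (1 : ℝ) < p := by exact_mod_cast hp.one_lt
  have hps : (1 : ℝ) < (p : ℝ) ^ s := one_lt_pow₀ hp1 (by omega)
  simp_rw [radicalTerm_prime_pow s hp]
  have h := (hasSum_geometric_of_lt_one (r := 1 / (p : ℝ) ^ s) (by positivity)
    (by rw [div_lt_one (by positivity)]; exact hps)).mul_left
    (-(p : ℝ) / (p : ℝ) ^ s * (1 / (p : ℝ) ^ s) ^ v)
  convert! h using 1
  · ext e; rw [pow_add]; ring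
  · have : (p : ℝ) ^ s - 1 ≠ 0 := by linarith
    rw [mul_comm v s, pow_mul, one_div_pow]
    field_simp

theorem tsum_radicalTerm_prime_pow {s : ℕ} (hs : 3 ≤ s) {p : ℕ} (hp : p.Prime) :
    ∑' e, radicalTerm s (p ^ e) = 1 - (p : ℝ) / ((p : ℝ) ^ s - 1) := by
  have h := hasSum_radicalTerm_prime_pow hs hp 0
  simp only [add_zero, zero_mul, pow_zero, div_one, one_mul] at h
  rw [((hasSum_nat_add_iff (f := fun e => radicalTerm s (p ^ e)) 1).mp h).tsum_eq]
  simp [radicalTerm_one]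
  ring

/-- Keeps the Euler factors and the denominators `p + 1 - p ^ s` away from zero. -/
theorem Nat.Prime.add_one_lt_pow {s : ℕ} (hs : 3 ≤ s) {p : ℕ} (hp : p.Prime) :
    (p : ℝ) + 1 < (p : ℝ) ^ s := by
  have hp1 : (2 : ℝ) ≤ p := by exact_mod_cast hp.two_le
  calc (p : ℝ) + 1 < p ^ 2 := by nlinarith
    _ ≤ _ := pow_le_pow_right₀ (by linarith) (by omega)

theorem tsum_radicalTerm_prime_pow_ne_zero {s : ℕ} (hs : 3 ≤ s) {p : ℕ} (hp : p.Prime) :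
    ∑' e, radicalTerm s (p ^ e) ≠ 0 := by
  have := hp.add_one_lt_pow hs
  rw [tsum_radicalTerm_prime_pow hs hp, sub_ne_zero, ne_comm, Ne, div_eq_one_iff_eq]
  · intro h; linarith
  · have : (0 : ℝ) ≤ p := by positivity
    linarith

theorem hasProd_radicalTerm {s : ℕ} (hs : 3 ≤ s) :
    HasProd (fun q : Nat.Primes => 1 - (q : ℝ) / ((q : ℝ) ^ s - 1)) (∑' k, radicalTerm s k) := by
  have h := EulerProduct.eulerProduct_hasProd (radicalTerm_one s) (radicalTerm_mul s)
    (summable_norm_radicalTerm hs) (radicalTerm_zero (by omega))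
  simpa only [fun q : Nat.Primes => tsum_radicalTerm_prime_pow hs q.2] using h

-- At `p ∣ D` the tail from exponent `v_p(D)` is divided by the full factor `(p ^ s - 1 - p) / (p ^
-- s - 1)`; the common denominator cancels.
open Finset in
theorem tsum_radicalTerm_ite_dvd {s : ℕ} (hs : 3 ≤ s) {D : ℕ} (hD : D ≠ 0) :
    ∑' k, (if D ∣ k then radicalTerm s k else 0) =
      (∏' q : Nat.Primes, (1 - (q : ℝ) / ((q : ℝ) ^ s - 1))) *
        ∏ p ∈ D.primeFactors, 1 / (p : ℝ) ^ ((D.factorization p - 1) * s) *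
          ((p : ℝ) / ((p : ℝ) + 1 - (p : ℝ) ^ s)) := by
  rw [(hasProd_radicalTerm hs).tprod_eq, tsum_ite_dvd_eq (radicalTerm_one s)
    (radicalTerm_zero (by omega)) (radicalTerm_mul s) (summable_norm_radicalTerm hs) hD
    fun p hp => tsum_radicalTerm_prime_pow_ne_zero hs (Nat.prime_of_mem_primeFactors hp)]
  congr 1
  refine prod_congr rfl fun p hpD => ?_
  have hp := Nat.prime_of_mem_primeFactors hpD
  have hE := tsum_radicalTerm_prime_pow_ne_zero hs hp
  obtain ⟨v, hv⟩ : ∃ v, D.factorization p = v + 1 := Nat.exists_eq_succ_of_ne_zero (by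
    rwa [← Finsupp.mem_support_iff, Nat.support_factorization])
  have h1 := (hasSum_nat_add_iff (f := fun e => radicalTerm s (p ^ e)) (v + 1)).mp (hasSum_radicalTerm_prime_pow hs hp v)
  have h2 := h1.tsum_eq
  rw [one_sub_div hE, hv, sub_eq_iff_eq_add.mpr (h2.trans rfl),
    tsum_radicalTerm_prime_pow hs hp, Nat.add_sub_cancel]
  have hlt := hp.add_one_lt_pow hs
  have hp0 : (0 : ℝ) < p := by exact_mod_cast hp.pos
  have h3 : (p : ℝ) ^ s - 1 ≠ 0 := by linarith
  have h4 : (p : ℝ) + 1 - (p : ℝ) ^ s ≠ 0 := by linarith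
  have h5 : (p : ℝ) ^ s - 1 - p ≠ 0 := by intro h; apply h4; linarith
  rw [one_sub_div h3]
  field_simp
  ring

/-! ### Discriminants of quadratic fields -/

/-- With simultaneous eigenvalues `x, x'` and `y, y'`, the left side is `(xy' - x'y)²`, while `s =
xy' + x'y` and `n = xx'yy'`. Applied to multiplication by an integral basis, this gives
Stickelberger's congruence. -/
theorem Int.discr_pair_emod_four {X Y : Matrix (Fin 2) (Fin 2) ℤ} (h : X * Y = Y * X) :
    ∃ s n : ℤ, (X * X).trace * (Y * Y).trace - (X * Y).trace * (X * Y).trace = s ^ 2 - 4 * n := by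
  have h00 := congrFun (congrFun h 0) 0
  have h01 := congrFun (congrFun h 0) 1
  simp only [Matrix.mul_apply, Fin.sum_univ_two] at h00 h01
  refine ⟨X.trace * Y.trace - (X * Y).trace, X.det * Y.det, ?_⟩
  simp only [Matrix.trace_fin_two, Matrix.det_fin_two, Matrix.mul_apply, Fin.sum_univ_two]
  have h1 : X 0 1 * Y 1 0 = Y 0 1 * X 1 0 := by linear_combination h00
  have h2 : (X 0 0 - X 1 1) * Y 0 1 = X 0 1 * (Y 0 0 - Y 1 1) := by linear_combination h01
  linear_combination 2 * ((X 0 0 - X 1 1) * Y 1 0 - X 1 0 * (Y 0 0 - Y 1 1)) * h2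
      - 2 * (X 0 1 * Y 1 0 - Y 0 1 * X 1 0) * h1

open NumberField Module in
/-- Stickelberger's congruence for quadratic number fields. -/
theorem NumberField.discr_emod_four_of_finrank_eq_two {K : Type*} [Field K] [NumberField K]
    (h2 : finrank ℚ K = 2) : discr K % 4 = 0 ∨ discr K % 4 = 1 := by
  have hcard : finrank ℤ (𝓞 K) = 2 := by rw [RingOfIntegers.rank, h2]
  let b : Basis (Fin 2) ℤ (𝓞 K) := finBasisOfFinrankEq ℤ (𝓞 K) hcard
  have hd : discr K = Algebra.discr ℤ b := (discr_eq_discr K b).symm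
  have htr : ∀ x y : 𝓞 K, Algebra.trace ℤ (𝓞 K) (x * y) =
      (Algebra.leftMulMatrix b x * Algebra.leftMulMatrix b y).trace := fun x y => by
    rw [Algebra.trace_eq_matrix_trace b, map_mul]
  obtain ⟨s, n, hs⟩ := Int.discr_pair_emod_four (X := Algebra.leftMulMatrix b (b 0))
    (Y := Algebra.leftMulMatrix b (b 1))
    ((map_mul _ _ _).symm.trans ((congrArg _ (mul_comm _ _)).trans (map_mul _ _ _)))
  rw [hd, Algebra.discr_def, Matrix.det_fin_two]
  simp only [Algebra.traceMatrix_apply, Algebra.traceForm_apply, htr]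
  rw [mul_comm] at hs
  have hc : Algebra.leftMulMatrix b (b 1) * Algebra.leftMulMatrix b (b 0) =
      Algebra.leftMulMatrix b (b 0) * Algebra.leftMulMatrix b (b 1) :=
    (map_mul _ _ _).symm.trans ((congrArg _ (mul_comm _ _)).trans (map_mul _ _ _))
  rw [hc, mul_comm, hs]
  rcases Int.even_or_odd' s with ⟨t, rfl | rfl⟩
  · left; ring_nf; omega
  · right; ring_nf; omega

-- The integer `n` is the determinant expressing `x, y` in an integral basis.
open NumberField Module in
theorem NumberField.exists_discr_pair_eq {K : Type*} [Field K] [NumberField K]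
    (h2 : finrank ℚ K = 2) (x y : 𝓞 K) :
    ∃ n : ℤ, Algebra.trace ℤ (𝓞 K) (x * x) * Algebra.trace ℤ (𝓞 K) (y * y) -
      Algebra.trace ℤ (𝓞 K) (x * y) ^ 2 = n ^ 2 * discr K := by
  have hcard : finrank ℤ (𝓞 K) = 2 := by rw [RingOfIntegers.rank, h2]
  let b : Basis (Fin 2) ℤ (𝓞 K) := finBasisOfFinrankEq ℤ (𝓞 K) hcard
  have h := Algebra.discr_of_matrix_vecMul b (b.toMatrix ![x, y])
  rw [Basis.toMatrix_map_vecMul, discr_eq_discr K b, Algebra.discr_def, Matrix.det_fin_two] at h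
  refine ⟨_, Eq.trans ?_ h⟩
  simp [Algebra.traceMatrix_apply, Algebra.traceForm_apply, mul_comm y x]
  ring

open NumberField Module in
theorem NumberField.trace_eq_zero_of_sq_eq {K : Type*} [Field K] [NumberField K]
    (h2 : finrank ℚ K = 2) {d : ℤ} (hd : ∀ a : ℤ, a * a ≠ d) {θ : 𝓞 K} (hθ : θ * θ = d) :
    Algebra.trace ℤ (𝓞 K) θ = 0 := by
  have hcard : finrank ℤ (𝓞 K) = 2 := by rw [RingOfIntegers.rank, h2]
  let b : Basis (Fin 2) ℤ (𝓞 K) := finBasisOfFinrankEq ℤ (𝓞 K) hcard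
  have hM : Algebra.leftMulMatrix b θ * Algebra.leftMulMatrix b θ = (d : Matrix _ _ ℤ) := by
    rw [← map_mul, hθ, map_intCast]
  rw [Algebra.trace_eq_matrix_trace b, Matrix.trace_fin_two]
  generalize Algebra.leftMulMatrix b θ = M at hM
  have h00 := congrFun (congrFun hM 0) 0
  have h01 := congrFun (congrFun hM 0) 1
  simp [Matrix.mul_apply, Fin.sum_univ_two, Matrix.intCast_apply] at h00 h01
  by_contra hne
  have : M 0 1 = 0 := by
    have : (M 0 0 + M 1 1) * M 0 1 = 0 := by linear_combination h01
    exact (mul_eq_zero.mp this).resolve_left hne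
  exact hd (M 0 0) (by rw [this] at h00; simpa using h00)

-- No integral basis is exhibited: the trace determinant of `1, (1 + θ)/2` or of `1, θ` is `n²`
-- times the discriminant. In the first case squarefreeness gives `n = ±1`. In the second, odd `n`
-- is a unit since `n²` is prime to 4, and even `n` would make `d` itself the discriminant, against
-- Stickelberger's congruence.
open NumberField Module in
theorem NumberField.discr_eq_of_sq_eq {K : Type*} [Field K] [NumberField K]
    (h2 : finrank ℚ K = 2) {d : ℤ} (hd : Squarefree d) (hd1 : d ≠ 1) {θ : 𝓞 K}
    (hθ : θ * θ = d) : discr K = if d % 4 = 1 then d else 4 * d := by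
  have hsq : ∀ a : ℤ, a * a ≠ d := fun a ha => by
    rcases Int.isUnit_iff.mp (hd a (Dvd.intro 1 (by rw [mul_one, ha]))) with rfl | rfl <;>
      simp at ha <;> exact hd1 ha.symm
  have hcard : finrank ℤ (𝓞 K) = 2 := by rw [RingOfIntegers.rank, h2]
  have htc : ∀ n : ℤ, Algebra.trace ℤ (𝓞 K) (n : 𝓞 K) = 2 * n := fun n => by
    have := Algebra.trace_algebraMap_of_basis (finBasisOfFinrankEq ℤ (𝓞 K) hcard) n
    simpa using this
  have ht1 : Algebra.trace ℤ (𝓞 K) (1 : 𝓞 K) = 2 := by simpa using htc 1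
  have htθ := trace_eq_zero_of_sq_eq h2 hsq hθ
  split_ifs with h4
  · have hω : IsIntegral ℤ (((1 : K) + θ) / 2) := by
      refine ⟨Polynomial.X ^ 2 - Polynomial.X - Polynomial.C ((d - 1) / 4), ?_, ?_⟩
      · monicity!
      · have : ((θ : K)) * θ = d := by
          have := congrArg (algebraMap (𝓞 K) K) hθ
          rwa [map_mul, map_intCast] at this
        have h5 : (((d - 1) / 4 : ℤ) : K) = ((d : K) - 1) / 4 := by
          rw [Int.cast_div (by omega) (by norm_num)]
          push_cast
          rfl
        rw [Polynomial.eval₂_sub, Polynomial.eval₂_sub, Polynomial.eval₂_pow, Polynomial.eval₂_X,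
          Polynomial.eval₂_C, eq_intCast, h5]
        linear_combination (1 / 4 : K) * this
    obtain ⟨ω, hωe⟩ : ∃ ω : 𝓞 K,
        algebraMap (𝓞 K) K ω = (1 + algebraMap (𝓞 K) K θ) / 2 := ⟨⟨_, hω⟩, rfl⟩
    have hω2 : (2 : 𝓞 K) * ω = 1 + θ := by
      apply FaithfulSMul.algebraMap_injective (𝓞 K) K
      rw [map_mul, map_add, map_one, map_ofNat, hωe]
      ring
    have htω : Algebra.trace ℤ (𝓞 K) ω = 1 := by
      have := congrArg (Algebra.trace ℤ (𝓞 K)) hω2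
      rw [map_add, ht1, htθ, two_mul, map_add] at this
      omega
    have htωω : 2 * Algebra.trace ℤ (𝓞 K) (ω * ω) = 1 + d := by
      have h6 : (4 : 𝓞 K) * (ω * ω) = ((1 + d : ℤ) : 𝓞 K) + (θ + θ) := by
        push_cast
        linear_combination (2 * ω + 1 + θ) * hω2 + hθ
      have h7 : (4 : 𝓞 K) * (ω * ω) = (4 : ℤ) • (ω * ω) := by simp
      have := congrArg (Algebra.trace ℤ (𝓞 K)) h6
      rw [h7, map_smul, map_add, map_add, htθ, htc, smul_eq_mul] at this
      omega
    obtain ⟨n, hn⟩ := exists_discr_pair_eq h2 1 ω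
    rw [mul_one, one_mul, ht1, htω, htωω] at hn
    have hn' : d = n * n * discr K := by linarith
    rcases Int.isUnit_iff.mp (hd n ⟨_, hn'⟩) with rfl | rfl <;> simpa using hn'.symm
  · obtain ⟨n, hn⟩ := exists_discr_pair_eq h2 1 θ
    rw [mul_one, one_mul, ht1, htθ, hθ, htc] at hn
    have hn' : 4 * d = n * n * discr K := by linarith
    rcases Int.even_or_odd' n with ⟨m, rfl | rfl⟩
    · have hm : d = m * m * discr K := by linarith
      have hdd : d = discr K := by
        rcases Int.isUnit_iff.mp (hd m ⟨_, hm⟩) with rfl | rfl <;> simpa using hm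
      have hmod := discr_emod_four_of_finrank_eq_two h2
      rw [← hdd] at hmod
      have h0 : d % 4 = 0 := hmod.resolve_right h4
      have := hd 2 (by omega)
      exact absurd this (by decide)
    · have hco : IsCoprime ((2 * m + 1) * (2 * m + 1)) (4 : ℤ) := by
        refine ⟨1, -(m * m + m), by ring⟩
      have hu := hd (2 * m + 1) (hco.dvd_of_dvd_mul_left ⟨_, hn'⟩)
      rcases Int.isUnit_iff.mp hu with h | h <;> rw [h] at hn' <;> simpa using hn'.symm

open IntermediateField in
theorem quadField_eq_adjoin {η : ℚ} {x : ℂ} (hx : x ^ 2 = η) : quadField η = ℚ⟮x⟯ := by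
  refine le_antisymm (adjoin_le_iff.mpr fun z hz => ?_)
    (adjoin_simple_le_iff.mpr (subset_adjoin _ _ hx))
  have hz' : z ^ 2 = x ^ 2 := by rw [hx]; exact hz
  rcases sq_eq_sq_iff_eq_or_eq_neg.mp hz' with rfl | rfl
  · exact mem_adjoin_simple_self _ _
  · exact neg_mem (mem_adjoin_simple_self _ _)

open NumberField Module IntermediateField in
theorem quadDiscr_eq {η : ℕ} (hη : Squarefree η) (hη1 : η ≠ 1) :
    quadDiscr (η : ℚ) = if η % 4 = 1 then (η : ℤ) else 4 * η := by
  obtain ⟨x, hx⟩ := IsAlgClosed.exists_pow_nat_eq (η : ℂ) two_pos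
  have hx' : x ^ 2 = ((η : ℚ) : ℂ) := by simpa using hx
  have hxK : x ∈ quadField (η : ℚ) := subset_adjoin _ _ hx'
  have hsqf : Squarefree (η : ℤ) := Int.squarefree_natCast.mpr hη
  have hint : IsIntegral ℚ x := IsIntegral.of_pow two_pos (hx' ▸ isIntegral_algebraMap)
  have h2 : finrank ℚ (quadField (η : ℚ)) = 2 := by
    rw [quadField_eq_adjoin hx', adjoin.finrank hint]
    refine le_antisymm ?_ ?_
    · have hdvd := minpoly.dvd ℚ x (p := Polynomial.X ^ 2 - Polynomial.C (η : ℚ)) (by simp [hx])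
      refine (Polynomial.natDegree_le_of_dvd hdvd
        (Polynomial.X_pow_sub_C_ne_zero two_pos _)).trans ?_
      rw [Polynomial.natDegree_X_pow_sub_C]
    · rw [minpoly.two_le_natDegree_iff hint]
      rintro ⟨q, rfl⟩
      have hq : q ^ 2 = η := by
        have : ((q ^ 2 : ℚ) : ℂ) = ((η : ℚ) : ℂ) := by rw [← hx']; simp
        exact_mod_cast this
      have : IsSquare η := by
        rw [← Rat.isSquare_natCast_iff]
        exact ⟨q, by rw [← hq, sq]⟩
      obtain ⟨a, rfl⟩ := this
      have := hη a (dvd_refl _)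
      simp at this
      simp [this] at hη1
  let θ : 𝓞 (quadField (η : ℚ)) := ⟨⟨x, hxK⟩, by
    refine IsIntegral.of_pow two_pos ?_
    have : (⟨x, hxK⟩ : quadField (η : ℚ)) ^ 2 = algebraMap ℤ _ (η : ℤ) :=
      Subtype.ext (by simpa using hx)
    rw [this]
    exact isIntegral_algebraMap⟩
  have hθ : θ * θ = ((η : ℤ) : 𝓞 (quadField (η : ℚ))) := by
    apply FaithfulSMul.algebraMap_injective (𝓞 (quadField (η : ℚ))) (quadField (η : ℚ))
    rw [map_mul, map_intCast]
    apply Subtype.ext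
    change x * x = ((η : ℤ) : ℂ)
    rw [← sq, hx]
    simp
  rw [quadDiscr, NumberField.discr_eq_of_sq_eq h2 hsqf (by exact_mod_cast hη1) hθ]
  refine if_congr (by omega) rfl rfl

/-! ### Cyclotomic fields and the square roots they contain -/

/-- The `k`-th cyclotomic field inside `ℂ`. -/
def cycField (k : ℕ) : IntermediateField ℚ ℂ :=
  IntermediateField.adjoin ℚ {Complex.exp (2 * Real.pi * Complex.I / k)}

instance cycField_isCyclotomicExtension (k : ℕ) [NeZero k] :
    IsCyclotomicExtension {k} ℚ (cycField k) := by
  have h := Complex.isPrimitiveRoot_exp k (NeZero.ne k)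
  change IsCyclotomicExtension {k} ℚ (cycField k).toSubalgebra
  rw [cycField, IntermediateField.adjoin_simple_toSubalgebra_of_isAlgebraic
    (h.isIntegral (NeZero.pos k)).tower_top.isAlgebraic]
  exact h.adjoin_isCyclotomicExtension ℚ

instance cycField_numberField (k : ℕ) [NeZero k] : NumberField (cycField k) :=
  IsCyclotomicExtension.numberField {k} ℚ _

theorem finrank_cycField (k : ℕ) [NeZero k] : Module.finrank ℚ (cycField k) = k.totient :=
  IsCyclotomicExtension.finrank (cycField k) (Polynomial.cyclotomic.irreducible_rat (NeZero.pos k))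

theorem exp_mem_cycField (k : ℕ) : Complex.exp (2 * Real.pi * Complex.I / k) ∈ cycField k :=
  IntermediateField.mem_adjoin_simple_self _ _

theorem mem_cycField_of_pow_eq_one {k : ℕ} [NeZero k] {z : ℂ} (hz : z ^ k = 1) :
    z ∈ cycField k := by
  obtain ⟨i, -, rfl⟩ := (Complex.isPrimitiveRoot_exp k (NeZero.ne k)).eq_pow_of_pow_eq_one hz
  exact pow_mem (exp_mem_cycField k) i

theorem exp_pow_eq_one (k : ℕ) [NeZero k] : Complex.exp (2 * Real.pi * Complex.I / k) ^ k = 1 :=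
  (Complex.isPrimitiveRoot_exp k (NeZero.ne k)).pow_eq_one

theorem cycField_le_of_exp_mem {k : ℕ} {F : IntermediateField ℚ ℂ}
    (h : Complex.exp (2 * Real.pi * Complex.I / k) ∈ F) : cycField k ≤ F :=
  IntermediateField.adjoin_simple_le_iff.mpr h

theorem cycField_mono {a b : ℕ} [NeZero b] (h : a ∣ b) : cycField a ≤ cycField b := by
  have : NeZero a := ⟨fun ha => NeZero.ne b (by simpa [ha] using h)⟩
  obtain ⟨c, rfl⟩ := h
  refine cycField_le_of_exp_mem (mem_cycField_of_pow_eq_one ?_)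
  rw [pow_mul, exp_pow_eq_one, one_pow]

theorem cycField_two_mul_le {m : ℕ} (hm : Odd m) : cycField (2 * m) ≤ cycField m := by
  have : NeZero m := ⟨fun h => by simp [h] at hm⟩
  refine cycField_le_of_exp_mem ?_
  rw [← neg_mem_iff]
  refine mem_cycField_of_pow_eq_one ?_
  have h := (Complex.isPrimitiveRoot_exp (2 * m) (NeZero.ne _)).pow (NeZero.pos _)
    (mul_comm 2 m)
  rw [hm.neg_pow, h.eq_neg_one_of_two_right, neg_neg]

theorem cycField_mul_le {a b : ℕ} [NeZero a] [NeZero b] (h : a.Coprime b)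
    {F : IntermediateField ℚ ℂ} (ha : cycField a ≤ F) (hb : cycField b ≤ F) :
    cycField (a * b) ≤ F := by
  refine cycField_le_of_exp_mem ?_
  set ζ := Complex.exp (2 * Real.pi * Complex.I / ((a * b : ℕ) : ℂ)) with hζ
  have hab : ζ ^ (a * b) = 1 := exp_pow_eq_one (a * b)
  have h1 : ζ ^ a ∈ F := hb (mem_cycField_of_pow_eq_one (by rw [← pow_mul, hab]))
  have h2 : ζ ^ b ∈ F := ha (mem_cycField_of_pow_eq_one (by rw [← pow_mul, mul_comm, hab]))
  have h3 : ζ = (ζ ^ a) ^ (Nat.gcdA a b) * (ζ ^ b) ^ (Nat.gcdB a b) := by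
    have hb := Nat.gcd_eq_gcd_ab a b
    rw [h.gcd_eq_one] at hb
    rw [← zpow_natCast, ← zpow_natCast, ← zpow_mul, ← zpow_mul,
      ← zpow_add₀ (by rw [hζ]; exact Complex.exp_ne_zero _), ← hb]
    simp
  rw [h3]
  exact mul_mem (zpow_mem h1 _) (zpow_mem h2 _)

theorem I_mem_cycField_four : Complex.I ∈ cycField 4 :=
  mem_cycField_of_pow_eq_one Complex.I_pow_four

theorem exists_sq_eq_two_mem_cycField_eight : ∃ w ∈ cycField 8, w ^ 2 = (2 : ℂ) := by
  have hp := Complex.isPrimitiveRoot_exp 8 (by norm_num)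
  have hmem := exp_mem_cycField 8
  set ζ := Complex.exp (2 * Real.pi * Complex.I / (8 : ℕ))
  have h4 : ζ ^ 4 = -1 := (hp.pow (by norm_num) (show 8 = 4 * 2 by norm_num)).eq_neg_one_of_two_right
  -- As `ζ ^ 4 = -1`, this is `ζ + ζ⁻¹ = 2 cos(π/4)`.
  refine ⟨ζ - ζ ^ 3, sub_mem hmem (pow_mem hmem 3), ?_⟩
  linear_combination (ζ ^ 2 - 2) * h4

/-- The root is the quadratic Gauss sum modulo `p`. -/
theorem exists_sq_eq_prime_mem_cycField {p : ℕ} (hp : p.Prime) (h2 : p ≠ 2) :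
    ∃ z ∈ cycField p, z ^ 2 = ((ZMod.χ₄ p * p : ℤ) : ℂ) := by
  have : Fact p.Prime := ⟨hp⟩
  have hchar : ringChar (ZMod p) ≠ 2 := by rwa [ZMod.ringChar_zmod_n]
  let χ : MulChar (ZMod p) ℂ := (quadraticChar (ZMod p)).ringHomComp (Int.castRingHom ℂ)
  let ψ : AddChar (ZMod p) ℂ := ZMod.stdAddChar
  have hinj : Function.Injective (Int.castRingHom ℂ) := Int.cast_injective
  have hψp : ψ.IsPrimitive := ZMod.isPrimitive_stdAddChar p
  refine ⟨gaussSum χ ψ, ?_, ?_⟩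
  · refine sum_mem fun a _ => mul_mem ?_ (mem_cycField_of_pow_eq_one ?_)
    · exact intCast_mem _ (quadraticChar (ZMod p) a)
    · rw [← AddChar.map_nsmul_eq_pow]
      rw [nsmul_eq_mul, CharP.cast_eq_zero, zero_mul, AddChar.map_zero_eq_one]
  · rw [gaussSum_sq ((MulChar.ringHomComp_ne_one_iff hinj).mpr
      (quadraticChar_ne_one hchar)) ((quadraticChar_isQuadratic (ZMod p)).comp _) hψp]
    have h1 : χ (-1) = ((ZMod.χ₄ p : ℤ) : ℂ) := by
      change ((quadraticChar (ZMod p) (-1) : ℤ) : ℂ) = _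
      rw [quadraticChar_neg_one hchar, ZMod.card]
    rw [h1, ZMod.card]
    push_cast
    rfl

theorem exists_sq_eq_mem_cycField {m : ℕ} (hm : Odd m) (hsq : Squarefree m) :
    ∃ z ∈ cycField m, z ^ 2 = ((ZMod.χ₄ m * m : ℤ) : ℂ) := by
  induction m using induction_on_primes with
  | zero => simp at hm
  | one => exact ⟨1, one_mem _, by simp⟩
  | prime_mul p a hp ih =>
    rw [Nat.odd_mul] at hm
    have : NeZero (p * a) := ⟨hsq.ne_zero⟩
    obtain ⟨z, hz, hz2⟩ := ih hm.2 hsq.of_mul_right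
    obtain ⟨w, hw, hw2⟩ := exists_sq_eq_prime_mem_cycField hp 
      (fun h => absurd (h ▸ hm.1) (by decide))
    refine ⟨w * z, mul_mem (cycField_mono (dvd_mul_right p a) hw)
      (cycField_mono (dvd_mul_left a p) hz), ?_⟩
    rw [mul_pow, hw2, hz2]
    push_cast
    rw [map_mul]
    push_cast
    ring

theorem mem_of_sq_eq_sq {F : IntermediateField ℚ ℂ} {x z : ℂ} (hz : z ∈ F) (h : x ^ 2 = z ^ 2) :
    x ∈ F := by
  rcases sq_eq_sq_iff_eq_or_eq_neg.mp h with rfl | rfl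
  · exact hz
  · exact neg_mem hz

theorem χ₄_cases {m : ℕ} (hm : Odd m) :
    (m % 4 = 1 ∧ ZMod.χ₄ m = 1) ∨ (m % 4 = 3 ∧ ZMod.χ₄ m = -1) := by
  rcases Nat.odd_mod_four_iff.mp (Nat.odd_iff.mp hm) with h | h
  · exact .inl ⟨h, ZMod.χ₄_nat_one_mod_four h⟩
  · exact .inr ⟨h, ZMod.χ₄_nat_three_mod_four h⟩

/-- A square root of an odd squarefree `m` lies in every cyclotomic field that contains `i` and the
`m`-th roots of unity. -/
theorem sqrt_mem_of_odd {F : IntermediateField ℚ ℂ} {m : ℕ} (hm : Odd m) (hsq : Squarefree m)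
    (hmF : cycField m ≤ F) (hI : m % 4 = 3 → Complex.I ∈ F) {x : ℂ} (hx : x ^ 2 = m) : x ∈ F := by
  obtain ⟨z, hz, hz2⟩ := exists_sq_eq_mem_cycField hm hsq
  rcases χ₄_cases hm with ⟨-, h⟩ | ⟨h3, h⟩
  · exact mem_of_sq_eq_sq (hmF hz) (by rw [hx, hz2, h]; simp)
  · refine mem_of_sq_eq_sq (mul_mem (hI h3) (hmF hz)) ?_
    rw [hx, mul_pow, hz2, h]
    simp

theorem sqrt_mem_cycField {η k : ℕ} [NeZero k] (hη : Squarefree η)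
    (h : (if η % 4 = 1 then η else 4 * η) ∣ k) {x : ℂ} (hx : x ^ 2 = η) : x ∈ cycField k := by
  split_ifs at h with h1
  · exact sqrt_mem_of_odd (Nat.odd_iff.mpr (by omega)) hη (cycField_mono h) (by omega) hx
  have hI : Complex.I ∈ cycField k := cycField_mono (dvd_of_mul_right_dvd h) I_mem_cycField_four
  rcases Nat.even_or_odd' η with ⟨m, rfl | rfl⟩
  · have hmodd : Odd m := by
      by_contra hcon
      rw [Nat.not_odd_iff_even, even_iff_two_dvd] at hcon
      have := hη 2 (mul_dvd_mul_left 2 hcon)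
      simp at this
    obtain ⟨w, hw, hw2⟩ := exists_sq_eq_two_mem_cycField_eight
    obtain ⟨y, hy⟩ := IsAlgClosed.exists_pow_nat_eq (m : ℂ) two_pos
    have hyk := sqrt_mem_of_odd (F := cycField k) hmodd hη.of_mul_right
      (cycField_mono (dvd_of_mul_left_dvd (dvd_of_mul_left_dvd h))) (fun _ => hI) hy
    have h8 : cycField 8 ≤ cycField k := cycField_mono ((Dvd.intro m (by ring)).trans h)
    refine mem_of_sq_eq_sq (mul_mem (h8 hw) hyk) ?_
    rw [hx, mul_pow, hw2, hy]
    push_cast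
    rfl
  · exact sqrt_mem_of_odd ⟨m, rfl⟩ hη (cycField_mono (dvd_of_mul_left_dvd h)) (fun _ => hI) hx

-- Ramification: the discriminant of a subfield divides that of `ℚ(ζ_k)`, which divides a power of
-- `k`.
open NumberField in
theorem prime_dvd_of_sqrt_mem_cycField {η : ℚ} {k : ℕ} [NeZero k] {x : ℂ} (hx : x ^ 2 = η)
    (hxk : x ∈ cycField k) {l : ℕ} (hl : l.Prime) (h : (l : ℤ) ∣ quadDiscr η) : l ∣ k := by
  have hle : quadField η ≤ cycField k := by
    rw [quadField_eq_adjoin hx]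
    exact IntermediateField.adjoin_simple_le_iff.mpr hxk
  let _ : Algebra (quadField η) (cycField k) := (IntermediateField.inclusion hle).toAlgebra
  have h1 : (l : ℤ) ∣ discr (cycField k) := h.trans (discr_dvd_discr (quadField η) (cycField k))
  have h2 := Int.natCast_dvd.mp h1
  rw [IsCyclotomicExtension.Rat.natAbs_discr k (cycField k)] at h2
  exact hl.dvd_of_dvd_pow
    (h2.trans (Nat.div_dvd_of_dvd (Nat.prod_primeFactors_pow_totient_ediv_dvd (NeZero.pos k))))

theorem cycField_eight_le {F : IntermediateField ℚ ℂ} (hI : Complex.I ∈ F) {w : ℂ} (hw : w ∈ F)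
    (hw2 : w ^ 2 = 2) : cycField 8 ≤ F := by
  refine cycField_le_of_exp_mem ?_
  have hp := Complex.isPrimitiveRoot_exp 8 (by norm_num)
  set ζ := Complex.exp (2 * Real.pi * Complex.I / (8 : ℕ))
  have h4 : (ζ ^ 2) ^ 2 = -1 := by
    rw [← pow_mul]
    exact (hp.pow (by norm_num) (show 8 = 4 * 2 by norm_num)).eq_neg_one_of_two_right
  have hζ2 : ζ ^ 2 = Complex.I ∨ ζ ^ 2 = -Complex.I := by
    apply sq_eq_sq_iff_eq_or_eq_neg.mp
    rw [h4, Complex.I_sq]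
  have hw0 : w ≠ 0 := by rintro rfl; norm_num at hw2
  rcases hζ2 with h | h
  · refine mem_of_sq_eq_sq (z := (1 + Complex.I) / w)
      (div_mem (add_mem (one_mem _) hI) hw) ?_
    rw [h, div_pow, hw2]
    linear_combination (-1 / 2 : ℂ) * Complex.I_sq
  · refine mem_of_sq_eq_sq (z := (1 - Complex.I) / w)
      (div_mem (sub_mem (one_mem _) hI) hw) ?_
    rw [h, div_pow, hw2]
    linear_combination (-1 / 2 : ℂ) * Complex.I_sq

/-- Otherwise `ℚ(ζ_{8m})`, of degree `4φ(m)`, would lie in a field of degree `2φ(m)`. -/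
theorem not_cycField_eight_le {m : ℕ} (hm : Odd m) : ¬ cycField 8 ≤ cycField (4 * m) := by
  intro h
  have : NeZero m := ⟨fun h => by simp [h] at hm⟩
  have h8 : Nat.Coprime 8 m := (Nat.Coprime.pow_left 3 (Nat.coprime_two_left.mpr hm) :)
  have h4 : Nat.Coprime 4 m := (Nat.Coprime.pow_left 2 (Nat.coprime_two_left.mpr hm) :)
  have hle := cycField_mul_le h8 h (cycField_mono (dvd_mul_left m 4))
  have hfin := IntermediateField.finrank_le_of_le_right hle
  rw [finrank_cycField, finrank_cycField, Nat.totient_mul h8, Nat.totient_mul h4,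
    show Nat.totient 8 = 4 by decide, show Nat.totient 4 = 2 by decide] at hfin
  have := Nat.totient_pos.mpr (NeZero.pos m)
  omega

/-- Ramification only yields `η ∣ k`; the powers of 2 need more. If `k = 2m` with `m` odd, then
`ℚ(ζ_k) = ℚ(ζ_m)`, where 2 cannot ramify. If `η` is even and `k = 4n` with `n` odd, dividing by the
square root of the odd part puts `√2`, hence `ζ₈`, into `ℚ(ζ_{4n})`. -/
theorem dvd_of_sqrt_mem_cycField {η k : ℕ} [NeZero k] (hη : Squarefree η) (hη1 : η ≠ 1)
    (hk : Even k) {x : ℂ} (hx : x ^ 2 = η) (hxk : x ∈ cycField k) :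
    (if η % 4 = 1 then η else 4 * η) ∣ k := by
  have hxq : x ^ 2 = ((η : ℚ) : ℂ) := by simpa using hx
  have hdvd : η ∣ k := by
    rw [← Nat.prod_primeFactors_of_squarefree hη]
    refine Finset.prod_primes_dvd _ (fun p hp => (Nat.prime_of_mem_primeFactors hp).prime)
      fun p hp => ?_
    refine prime_dvd_of_sqrt_mem_cycField hxq hxk (Nat.prime_of_mem_primeFactors hp) ?_
    have hpη : (p : ℤ) ∣ η := Int.natCast_dvd_natCast.mpr (Nat.dvd_of_mem_primeFactors hp)
    rw [quadDiscr_eq hη hη1]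
    split_ifs
    · exact hpη
    · exact hpη.mul_left 4
  split_ifs with h1
  · exact hdvd
  have h4 : 4 ∣ k := by
    by_contra hcon
    obtain ⟨m, rfl⟩ := hk.two_dvd
    have hm : Odd m := by
      rw [← Nat.not_even_iff_odd, even_iff_two_dvd]
      exact fun h => hcon (mul_dvd_mul_left 2 h)
    have : NeZero m := ⟨fun h => by simp [h] at hm⟩
    refine hm.not_two_dvd_nat (prime_dvd_of_sqrt_mem_cycField hxq (cycField_two_mul_le hm hxk)
      Nat.prime_two ?_)
    rw [quadDiscr_eq hη hη1, if_neg h1]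
    exact ⟨2 * η, by push_cast; ring⟩
  rcases Nat.even_or_odd' η with ⟨m, rfl | rfl⟩
  · have hmodd : Odd m := by
      by_contra hcon
      rw [Nat.not_odd_iff_even, even_iff_two_dvd] at hcon
      have := hη 2 (mul_dvd_mul_left 2 hcon)
      simp at this
    have hco : Nat.Coprime 8 m := (Nat.Coprime.pow_left 3 (Nat.coprime_two_left.mpr hmodd) :)
    have hmk : m ∣ k := dvd_of_mul_left_dvd hdvd
    rw [← mul_assoc]
    refine hco.mul_dvd_of_dvd_of_dvd ?_ hmk
    by_contra hcon
    obtain ⟨n, rfl⟩ := h4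
    have hn : Odd n := by
      rw [← Nat.not_even_iff_odd, even_iff_two_dvd]
      exact fun h => hcon (mul_dvd_mul_left 4 h)
    have hI : Complex.I ∈ cycField (4 * n) := cycField_mono (dvd_mul_right 4 n) I_mem_cycField_four
    obtain ⟨y, hy⟩ := IsAlgClosed.exists_pow_nat_eq (m : ℂ) two_pos
    have hym := sqrt_mem_of_odd (F := cycField (4 * n)) hmodd hη.of_mul_right (cycField_mono hmk)
      (fun _ => hI) hy
    have hm0 : (m : ℂ) ≠ 0 := by
      rw [Nat.cast_ne_zero]
      rintro rfl
      simp at hmodd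
    refine not_cycField_eight_le hn (cycField_eight_le hI (div_mem hxk hym) ?_)
    rw [div_pow, hx, hy]
    push_cast
    field_simp
  · have hco : Nat.Coprime 4 (2 * m + 1) :=
      (Nat.Coprime.pow_left 2 (Nat.coprime_two_left.mpr ⟨m, rfl⟩) :)
    exact hco.mul_dvd_of_dvd_of_dvd h4 hdvd

/-! ### Kummer theory -/

open IntermediateField Polynomial in
theorem isGalois_adjoin_range_of_pow_mem {K E A : Type*} [Field K] [Field E] [Algebra K E]
    [CharZero K] {n : ℕ} (hn : n ≠ 0) {ζ : K} (hζ : IsPrimitiveRoot ζ n) (φ : A → E)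
    (hφ : ∀ a, ∃ c : K, φ a ^ n = algebraMap K E c) :
    IsGalois K (adjoin K (Set.range φ)) := by
  set L := adjoin K (Set.range φ)
  have hint : ∀ a, IsIntegral K (φ a) := fun a => by
    obtain ⟨c, hc⟩ := hφ a
    exact IsIntegral.of_pow (Nat.pos_of_ne_zero hn) (hc ▸ isIntegral_algebraMap)
  have halg : Algebra.IsAlgebraic K L :=
    isAlgebraic_adjoin (by rintro _ ⟨a, rfl⟩; exact hint a)
  have hnorm : Normal K L := by
    refine normal_iff.mpr fun x => ⟨(halg.isAlgebraic x).isIntegral, ?_⟩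
    rw [← minpoly.algebraMap_eq (algebraMap L E).injective x]
    refine IntermediateField.splits_of_mem_adjoin (S := Set.range φ) (splits := ?_) (hx := x.2)
    rintro _ ⟨a, rfl⟩
    refine ⟨hint a, ?_⟩
    obtain ⟨c, hc⟩ := hφ a
    have haL : φ a ∈ L := subset_adjoin K _ ⟨a, rfl⟩
    have hs := X_pow_sub_C_splits_of_isPrimitiveRoot (hζ.map_of_injective (algebraMap K L).injective)
      (α := ⟨φ a, haL⟩) (a := algebraMap K L c) (Subtype.ext hc)
    refine Splits.of_dvd hs (X_pow_sub_C_ne_zero (Nat.pos_of_ne_zero hn) _) ?_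
    have := Polynomial.map_dvd (algebraMap K L) (minpoly.dvd K (φ a) (p := X ^ n - C c)
      (by simp [hc]))
    simpa using this
  exact { }

open IntermediateField in
/-- Kummer theory: adjoining `n`-th roots, forming a group `φ(A)`, to a field that contains the
`n`-th roots of unity gives an extension whose degree is the index of the base field part. -/
theorem finrank_adjoin_range_eq_index {K E A : Type*} [Field K] [Field E] [Algebra K E]
    [CharZero K] [CommGroup A] {n : ℕ} (hn : n ≠ 0) {ζ : K} (hζ : IsPrimitiveRoot ζ n)
    (φ : A →* E) (hφ : ∀ a, ∃ c : K, φ a ^ n = algebraMap K E c) (H : Subgroup A)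
    (hH : ∀ a, a ∈ H ↔ ∃ c : K, algebraMap K E c = φ a) :
    Module.finrank K (adjoin K (Set.range φ)) = H.index := by
  have hgal := isGalois_adjoin_range_of_pow_mem hn hζ φ hφ
  set L := adjoin K (Set.range φ) with hL
  have hmem : ∀ a, φ a ∈ L := fun a => subset_adjoin K _ ⟨a, rfl⟩
  let ψ : A →* L := φ.codRestrict L hmem
  have hψ0 : ∀ a, ψ a ≠ 0 := fun a h => by
    have : ψ a * ψ a⁻¹ = 1 := by rw [← map_mul, mul_inv_cancel, map_one]
    simp [h] at this
  have hψn : ∀ a, ∃ c : K, ψ a ^ n = algebraMap K L c := fun a => by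
    obtain ⟨c, hc⟩ := hφ a
    exact ⟨c, Subtype.ext hc⟩
  have hψH : ∀ a, a ∈ H ↔ ∃ c : K, algebraMap K L c = ψ a := fun a => by
    rw [hH]
    exact exists_congr fun c => ⟨fun h => Subtype.ext h, fun h => congrArg Subtype.val h⟩
  have hroot : ∀ (a : A) (σ : L ≃ₐ[K] L), ∃ c : K, σ (ψ a) / ψ a = algebraMap K L c := by
    intro a σ
    have h1 : (σ (ψ a) / ψ a) ^ n = 1 := by
      obtain ⟨c, hc⟩ := hψn a
      rw [div_pow, ← map_pow, hc, σ.commutes, ← hc, div_self (pow_ne_zero _ (hψ0 a))]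
    have hζL := hζ.map_of_injective (algebraMap K L).injective
    have : NeZero n := ⟨hn⟩
    obtain ⟨i, -, hi⟩ := hζL.eq_pow_of_pow_eq_one h1
    exact ⟨ζ ^ i, by rw [map_pow, hi]⟩
  -- The Kummer character of `a`; it is multiplicative because its values lie in `K` and so are
  -- fixed by the Galois group.
  let χ : A → ((L ≃ₐ[K] L) →* L) := fun a =>
    { toFun := fun σ => σ (ψ a) / ψ a
      map_one' := div_self (hψ0 a)
      map_mul' := fun σ τ => by
        obtain ⟨c, hc⟩ := hroot a τ
        have h1 : τ (ψ a) = algebraMap K L c * ψ a := by rw [← hc, div_mul_cancel₀ _ (hψ0 a)]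
        rw [AlgEquiv.mul_apply, h1, map_mul, σ.commutes]
        field_simp [hψ0 a] }
  let v : A ⧸ H → L := fun q => ψ q.out
  -- If two characters agree, the quotient of the representatives is Galois-invariant, so it lies in
  -- `K` and the cosets coincide.
  have hχ : Function.Injective fun q : A ⧸ H => χ q.out := by
    intro q q' h
    have hfix : ψ (q.out⁻¹ * q'.out) ∈ (⊥ : IntermediateField K L) := by
      rw [InfiniteGalois.mem_bot_iff_fixed]
      intro σ
      have h1 : σ (ψ q.out) / ψ q.out = σ (ψ q'.out) / ψ q'.out := DFunLike.congr_fun h σ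
      have h2 : ψ (q.out⁻¹ * q'.out) = ψ q'.out / ψ q.out := by
        rw [eq_div_iff (hψ0 _), ← map_mul]
        congr 1
        rw [mul_comm, mul_inv_cancel_left]
      rw [h2, map_div₀]
      have h3 := hψ0 q.out
      have h4 := hψ0 q'.out
      have h5 : σ (ψ q.out) ≠ 0 := by simpa using h3
      field_simp at h1 ⊢
      rw [h1]
    have h6 := (hψH _).mpr (mem_bot.mp hfix)
    rw [← QuotientGroup.out_eq' q, ← QuotientGroup.out_eq' q']
    exact QuotientGroup.eq.mpr h6
  -- Applying every `σ` to a relation among the `v q` gives a relation among distinct characters,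
  -- excluded by Dedekind's theorem.
  have hli : LinearIndependent K v := by
    rw [linearIndependent_iff']
    intro s g hg q hq
    have hd := (linearIndependent_monoidHom (L ≃ₐ[K] L) L).comp _ hχ
    rw [linearIndependent_iff'] at hd
    have h0 := hd s (fun q => algebraMap K L (g q) * v q) ?_ q hq
    · simpa [v, hψ0] using h0
    · ext1 σ
      have := congrArg σ hg
      simp only [map_sum, map_zero, Algebra.smul_def, map_mul, σ.commutes] at this
      rw [Finset.sum_apply, Pi.zero_apply, ← this]
      refine Finset.sum_congr rfl fun q _ => ?_
      change algebraMap K L (g q) * ψ q.out * (σ (ψ q.out) / ψ q.out) = _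
      rw [mul_assoc, mul_div_cancel₀ _ (hψ0 _)]
  have hψspan : ∀ a, ψ a ∈ Submodule.span K (Set.range v) := by
    intro a
    obtain ⟨c, hc⟩ := (hψH _).mp (QuotientGroup.eq.mp (QuotientGroup.out_eq' (a : A ⧸ H)))
    have : ψ a = c • v (a : A ⧸ H) := by
      rw [Algebra.smul_def, hc, ← map_mul]
      congr 1
      rw [mul_comm, mul_inv_cancel_left]
    rw [this]
    exact Submodule.smul_mem _ _ (Submodule.subset_span ⟨_, rfl⟩)
  -- The range of `φ` is closed under multiplication, so the algebra it generates is its linear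
  -- span.
  have hspan : ⊤ ≤ Submodule.span K (Set.range v) := by
    rintro x -
    have hx : (x : E) ∈ Submodule.span K (Set.range φ) := by
      have h2 : L.toSubalgebra = Algebra.adjoin K (Set.range φ) := by
        refine adjoin_toSubalgebra_of_isAlgebraic ?_
        rintro _ ⟨a, rfl⟩
        obtain ⟨c, hc⟩ := hφ a
        exact (IsIntegral.of_pow (Nat.pos_of_ne_zero hn)
          (hc ▸ isIntegral_algebraMap)).isAlgebraic
      have h1 : (x : E) ∈ Algebra.adjoin K (Set.range φ) := h2 ▸ x.2
      rwa [← Subalgebra.mem_toSubmodule, Algebra.adjoin_eq_span, ← MonoidHom.coe_mrange,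
        Submonoid.closure_eq] at h1
    have hle : Submodule.span K (Set.range φ) ≤
        (Submodule.span K (Set.range v)).map L.val.toLinearMap := by
      rw [Submodule.span_le]
      rintro _ ⟨a, rfl⟩
      exact ⟨ψ a, hψspan a, rfl⟩
    obtain ⟨z, hz, hzx⟩ := hle hx
    rwa [← Subtype.ext (show (z : E) = x from hzx)]
  rw [Module.finrank_eq_nat_card_basis (Module.Basis.mk hli hspan)]
  rfl

/-! ### Products of distinct primes -/

section PrimeProducts

open Finset

variable {r : ℕ} {p : Fin r → ℕ}

theorem prime_dvd_prod_iff_mem (hp : ∀ i, (p i).Prime) (hinj : Function.Injective p)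
    {i : Fin r} {S : Finset (Fin r)} : p i ∣ ∏ j ∈ S, p j ↔ i ∈ S := by
  rw [(hp i).prime.dvd_finsetProd_iff]
  refine ⟨fun ⟨j, hj, h⟩ => ?_, fun h => ⟨i, h, dvd_rfl⟩⟩
  rwa [hinj ((Nat.prime_dvd_prime_iff_eq (hp i) (hp j)).mp h)]

theorem prod_primes_injective (hp : ∀ i, (p i).Prime) (hinj : Function.Injective p) :
    Function.Injective fun S : Finset (Fin r) => ∏ i ∈ S, p i := by
  intro S T h
  ext i
  rw [← prime_dvd_prod_iff_mem hp hinj, ← prime_dvd_prod_iff_mem hp hinj (S := T)]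
  exact iff_of_eq (congrArg _ h)

theorem squarefree_prod_primes (hp : ∀ i, (p i).Prime) (hinj : Function.Injective p)
    (S : Finset (Fin r)) : Squarefree (∏ i ∈ S, p i) := by
  refine Finset.squarefree_prod_of_pairwise_isCoprime (fun i _ j _ hij => ?_)
    fun i _ => (hp i).prime.squarefree
  rw [Function.onFun, ← Nat.coprime_iff_isRelPrime]
  exact (Nat.coprime_primes (hp i) (hp j)).mpr (hinj.ne hij)

theorem dvd_prod_primes_iff (hp : ∀ i, (p i).Prime) (hinj : Function.Injective p) {d : ℕ} :
    d ∣ ∏ i, p i ↔ ∃ S : Finset (Fin r), ∏ i ∈ S, p i = d := by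
  refine ⟨fun h => ⟨univ.filter fun i => p i ∣ d, ?_⟩, ?_⟩
  · refine Eq.trans ?_ (Nat.prod_primeFactors_of_squarefree
      ((squarefree_prod_primes hp hinj univ).squarefree_of_dvd h))
    rw [← prod_image (s := univ.filter fun i => p i ∣ d) (f := fun q => q) (g := p)
        (fun _ _ _ _ h => hinj h)]
    have hd0 : d ≠ 0 := ((squarefree_prod_primes hp hinj univ).squarefree_of_dvd h).ne_zero
    refine prod_congr ?_ fun _ _ => rfl
    ext q
    rw [mem_image, Nat.mem_primeFactors]
    constructor
    · rintro ⟨i, hi, rfl⟩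
      exact ⟨hp i, (mem_filter.mp hi).2, hd0⟩
    · rintro ⟨hq, hqd, -⟩
      obtain ⟨i, -, hi⟩ := (hq.prime.dvd_finsetProd_iff _).mp (hqd.trans h)
      have := (Nat.prime_dvd_prime_iff_eq hq (hp i)).mp hi
      subst this
      exact ⟨i, by simpa using hqd, rfl⟩
  · rintro ⟨S, rfl⟩
    exact prod_dvd_prod_of_subset _ _ _ (subset_univ S)

theorem padicValRat_prod_zpow (hp : ∀ i, (p i).Prime) (hinj : Function.Injective p)
    (e : Fin r → ℤ) (j : Fin r) : padicValRat (p j) (∏ i, (p i : ℚ) ^ e i) = e j := by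
  have : Fact (p j).Prime := ⟨hp j⟩
  have hp0 : ∀ i, (p i : ℚ) ≠ 0 := fun i => by exact_mod_cast (hp i).ne_zero
  have h : ∀ S : Finset (Fin r), padicValRat (p j) (∏ i ∈ S, (p i : ℚ) ^ e i) =
      ∑ i ∈ S, e i * padicValRat (p j) (p i) := by
    intro S
    induction S using Finset.induction_on with
    | empty => simp
    | insert i S hi ih =>
      rw [prod_insert hi, sum_insert hi, padicValRat.mul (zpow_ne_zero _ (hp0 i))
        (prod_ne_zero_iff.mpr fun i _ => zpow_ne_zero _ (hp0 i)), ih, padicValRat.zpow]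
  rw [h, sum_eq_single j]
  · rw [padicValRat.self (hp j).one_lt, mul_one]
  · intro i _ hij
    have : Fact (p i).Prime := ⟨hp i⟩
    rw [padicValRat.of_nat, padicValNat_primes (hinj.ne hij.symm)]
    simp
  · simp

end PrimeProducts

/-! ### Real radicals and the Kummer field they generate -/

/-- A positive real element of a cyclotomic field one of whose powers is rational has a rational
square: its conjugates are real because the Galois group is abelian. -/
theorem exists_rat_eq_sq_of_mem_cycField {k : ℕ} [NeZero k] {x : ℝ} {q : ℚ}
    (hxk : (x : ℂ) ∈ cycField k) {n : ℕ} (hn : n ≠ 0) (hq : x ^ n = q) : ∃ c : ℚ, x ^ 2 = c := by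
  have hab : IsAbelianGalois ℚ (cycField k) := IsCyclotomicExtension.isAbelianGalois {k} ℚ _
  let c : cycField k ≃ₐ[ℚ] cycField k :=
    (Complex.conjAe.restrictScalars ℚ).restrictNormal (cycField k)
  have hc : ∀ y : cycField k, ((c y : cycField k) : ℂ) = starRingEnd ℂ (y : ℂ) := fun y =>
    AlgEquiv.restrictNormal_commutes (Complex.conjAe.restrictScalars ℚ) (cycField k) y
  let X : cycField k := ⟨x, hxk⟩
  have hcX : c X = X := Subtype.ext ((hc X).trans (Complex.conj_ofReal x))
  have hXn : X ^ n = algebraMap ℚ (cycField k) q := by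
    apply Subtype.ext
    change (x : ℂ) ^ n = ((q : ℚ) : ℂ)
    exact_mod_cast congrArg Complex.ofReal hq
  have hfix : X ^ 2 ∈ (⊥ : IntermediateField ℚ (cycField k)) := by
    rw [InfiniteGalois.mem_bot_iff_fixed]
    intro σ
    have hreal : starRingEnd ℂ ((σ X : cycField k) : ℂ) = (σ X : cycField k) := by
      rw [← hc, ← AlgEquiv.mul_apply, mul_comm' c σ, AlgEquiv.mul_apply, hcX]
    obtain ⟨y, hy⟩ := Complex.conj_eq_iff_real.mp hreal
    have hyn : y ^ n = x ^ n := by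
      have h1 : (σ X) ^ n = X ^ n := by rw [← map_pow, hXn, σ.commutes]
      have h2 := congrArg (Subtype.val : cycField k → ℂ) h1
      have h3 : ((σ X : cycField k) : ℂ) ^ n = (x : ℂ) ^ n := h2
      rw [hy] at h3
      exact_mod_cast h3
    -- Reals with equal `n`-th powers agree up to sign, so `σ X = ±X` and `X ^ 2` is fixed.
    have habs : |y| = |x| := by
      refine (pow_left_inj₀ (abs_nonneg _) (abs_nonneg _) hn).mp ?_
      rw [← abs_pow, ← abs_pow, hyn]
    rw [map_pow]
    apply Subtype.ext
    change ((σ X : cycField k) : ℂ) ^ 2 = (x : ℂ) ^ 2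
    rw [hy]
    exact_mod_cast (sq_eq_sq_iff_abs_eq_abs _ _).mpr habs
  obtain ⟨a, ha⟩ := IntermediateField.mem_bot.mp hfix
  refine ⟨a, ?_⟩
  have h : ((a : ℚ) : ℂ) = (x : ℂ) ^ 2 := congrArg (Subtype.val : cycField k → ℂ) ha
  exact_mod_cast h.symm

section RootHom

open Finset

variable {r : ℕ} {p : Fin r → ℕ} {k : ℕ}

/-- The homomorphism `e ↦ ∏ pᵢ^{eᵢ/k}` given by positive real `k`-th roots. -/
def rootHom (hp : ∀ i, (p i).Prime) (k : ℕ) : Multiplicative (Fin r → ℤ) →* ℝ where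
  toFun e := ∏ i, (p i : ℝ) ^ ((e.toAdd i : ℝ) / k)
  map_one' := by simp
  map_mul' e f := by
    rw [← prod_mul_distrib]
    refine prod_congr rfl fun i _ => ?_
    rw [← Real.rpow_add (by exact_mod_cast (hp i).pos)]
    congr 1
    simp [add_div]

theorem rootHom_apply (hp : ∀ i, (p i).Prime) (e : Fin r → ℤ) :
    rootHom hp k (Multiplicative.ofAdd e) = ∏ i, (p i : ℝ) ^ ((e i : ℝ) / k) := rfl

theorem rootHom_pos (hp : ∀ i, (p i).Prime) (e : Multiplicative (Fin r → ℤ)) :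
    0 < rootHom hp k e := by
  change 0 < ∏ i, (p i : ℝ) ^ ((e.toAdd i : ℝ) / k)
  refine prod_pos fun i _ => Real.rpow_pos_of_pos ?_ _
  exact_mod_cast (hp i).pos

theorem rootHom_pow (hp : ∀ i, (p i).Prime) (hk : k ≠ 0) (e : Fin r → ℤ) :
    rootHom hp k (Multiplicative.ofAdd e) ^ k = ((∏ i, (p i : ℚ) ^ e i : ℚ) : ℝ) := by
  rw [rootHom_apply, ← prod_pow]
  push_cast
  refine prod_congr rfl fun i _ => ?_
  rw [← Real.rpow_natCast, ← Real.rpow_mul (by positivity), div_mul_cancel₀ _ (by exact_mod_cast hk),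
    Real.rpow_intCast]

theorem rootHom_mul_left (hp : ∀ i, (p i).Prime) (hk : k ≠ 0) (e : Fin r → ℤ) :
    rootHom hp k (Multiplicative.ofAdd fun i => k * e i) = ((∏ i, (p i : ℚ) ^ e i : ℚ) : ℝ) := by
  rw [rootHom_apply]
  push_cast
  refine prod_congr rfl fun i _ => ?_
  rw [mul_div_cancel_left₀ _ (by exact_mod_cast hk), Real.rpow_intCast]

theorem rootHom_half_sq (hp : ∀ i, (p i).Prime) (hk : k ≠ 0) (hk2 : Even k)
    (S : Finset (Fin r)) :
    rootHom hp k (Multiplicative.ofAdd fun i => if i ∈ S then ((k / 2 : ℕ) : ℤ) else 0) ^ 2 =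
      ((∏ i ∈ S, p i : ℕ) : ℝ) := by
  obtain ⟨m, rfl⟩ := hk2.two_dvd
  have hsq : (Multiplicative.ofAdd fun i => if i ∈ S then ((2 * m / 2 : ℕ) : ℤ) else 0) ^ 2 =
      Multiplicative.ofAdd fun i => ((2 * m : ℕ) : ℤ) * if i ∈ S then 1 else 0 := by
    rw [← ofAdd_nsmul]
    congr 1
    ext i
    simp
  rw [← map_pow, hsq, rootHom_mul_left hp hk]
  push_cast
  rw [← prod_subset (subset_univ S)]
  · exact prod_congr rfl fun i hi => by simp [hi]
  · intro i _ hi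
    simp [hi]

-- A `k`-th root of an element of `Γ` is a positive real one times a `k`-th root of unity, so the
-- image of `rootHom` suffices.
open IntermediateField in
theorem kummerField_eq (hp : ∀ i, (p i).Prime) [NeZero k] {Γ : Subgroup ℚˣ}
    (hΓ : Γ = Subgroup.closure {u : ℚˣ | ∃ i, (u : ℚ) = (p i : ℚ)}) :
    kummerField Γ k = (adjoin (cycField k)
      (Set.range (Complex.ofRealHom.toMonoidHom.comp (rootHom hp k)))).restrictScalars ℚ := by
  have hk := NeZero.ne k
  have hΓe : ∀ g ∈ Γ, ∃ e : Fin r → ℤ, (g : ℚ) = ∏ i, (p i : ℚ) ^ e i := by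
    intro g hg
    rw [hΓ] at hg
    have hp0 : ∀ i, (p i : ℚ) ≠ 0 := fun i => by exact_mod_cast (hp i).ne_zero
    induction hg using Subgroup.closure_induction with
    | mem x hx =>
      obtain ⟨i, hi⟩ := hx
      refine ⟨Pi.single i 1, ?_⟩
      rw [hi, prod_eq_single i] <;> simp +contextual
    | one => exact ⟨0, by simp⟩
    | mul x y _ _ hx hy =>
      obtain ⟨e, he⟩ := hx
      obtain ⟨f, hf⟩ := hy
      exact ⟨e + f, by simp [he, hf, zpow_add₀ (hp0 _), prod_mul_distrib]⟩
    | inv x _ hx =>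
      obtain ⟨e, he⟩ := hx
      exact ⟨-e, by simp [he]⟩
  apply le_antisymm
  · refine adjoin_le_iff.mpr ?_
    have hcyc : ∀ z ∈ cycField k, z ∈ (adjoin (cycField k)
        (Set.range (Complex.ofRealHom.toMonoidHom.comp (rootHom hp k)))).restrictScalars ℚ :=
      fun z hz => (adjoin (cycField k) _).algebraMap_mem ⟨z, hz⟩
    rintro z (hz | ⟨g, hg, hz⟩)
    · exact hcyc z (mem_cycField_of_pow_eq_one hz.pow_eq_one)
    · obtain ⟨e, he⟩ := hΓe g hg
      set x := rootHom hp k (Multiplicative.ofAdd e) with hx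
      have hx0 : (x : ℂ) ≠ 0 := by exact_mod_cast (rootHom_pos hp _).ne'
      have hxk : (x : ℂ) ^ k = ((g : ℚ) : ℂ) := by
        rw [he]
        exact_mod_cast congrArg Complex.ofReal (rootHom_pow hp hk e)
      rw [show z = z / x * x by field_simp]
      refine mul_mem (hcyc _ (mem_cycField_of_pow_eq_one ?_))
        (subset_adjoin (cycField k) _ ⟨Multiplicative.ofAdd e, rfl⟩)
      rw [div_pow, hz, hxk, div_self]
      exact_mod_cast g.ne_zero
  · have hle : cycField k ≤ kummerField Γ k :=
      cycField_le_of_exp_mem (subset_adjoin _ _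
        (Or.inl (Complex.isPrimitiveRoot_exp k hk)))
    have : adjoin (cycField k) (Set.range (Complex.ofRealHom.toMonoidHom.comp (rootHom hp k))) ≤
        extendScalars hle := by
      refine adjoin_le_iff.mpr ?_
      rintro _ ⟨e, rfl⟩
      refine subset_adjoin ℚ _ (Or.inr ?_)
      let u : Fin r → ℚˣ := fun i => Units.mk0 (p i : ℚ) (by exact_mod_cast (hp i).ne_zero)
      refine ⟨∏ i, u i ^ (e.toAdd i), ?_, ?_⟩
      · rw [hΓ]
        exact prod_mem fun i _ => Subgroup.zpow_mem _ (Subgroup.subset_closure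
          (show u i ∈ {u : ℚˣ | ∃ i, (u : ℚ) = (p i : ℚ)} from ⟨i, rfl⟩)) _
      · have h1 : ((∏ i, u i ^ (e.toAdd i) : ℚˣ) : ℚ) = ∏ i, (p i : ℚ) ^ e.toAdd i := by
          simp [u]
        rw [h1]
        have h2 := congrArg Complex.ofReal (rootHom_pow hp hk e.toAdd)
        push_cast at h2 ⊢
        exact h2
    exact this

end RootHom

/-! ### Degree of the Kummer field -/

/-- The least common multiple of `2` and the discriminant of `ℚ(√η)`, for squarefree `η > 1`. -/
def evenConductor (η : ℕ) : ℕ := if η % 4 = 1 then 2 * η else 4 * η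

/-- Evenness is built in because `√η` is a `k`-th root of an element of `Γ` through the exponent
`k/2`; for odd `k` no `η` may count. -/
theorem evenConductor_dvd_iff {η k : ℕ} [NeZero k] (hη : Squarefree η) (hη1 : η ≠ 1) {x : ℂ}
    (hx : x ^ 2 = η) : evenConductor η ∣ k ↔ Even k ∧ x ∈ cycField k := by
  constructor
  · intro h
    refine ⟨?_, sqrt_mem_cycField hη (dvd_trans ?_ h) hx⟩
    · refine even_iff_two_dvd.mpr (dvd_trans ?_ h)
      rw [evenConductor]
      split_ifs
      · exact dvd_mul_right 2 η
      · exact ⟨2 * η, by ring⟩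
    · rw [evenConductor]
      split_ifs
      · exact dvd_mul_left η 2
      · exact dvd_rfl
  · rintro ⟨hk, hxk⟩
    have h := dvd_of_sqrt_mem_cycField hη hη1 hk hx hxk
    rw [evenConductor]
    split_ifs at h ⊢ with h1
    · refine Nat.Coprime.mul_dvd_of_dvd_of_dvd ?_ hk.two_dvd h
      rw [Nat.coprime_two_left, Nat.odd_iff]
      omega
    · exact h

section Degree

open Finset

variable {r : ℕ} {p : Fin r → ℕ} {k : ℕ}

/-- The exponents whose real `k`-th root lies in the `k`-th cyclotomic field. -/
def cycExponents (hp : ∀ i, (p i).Prime) (k : ℕ) : Subgroup (Multiplicative (Fin r → ℤ)) where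
  carrier := {e | ((rootHom hp k e : ℝ) : ℂ) ∈ cycField k}
  mul_mem' {e f} he hf := by
    rw [Set.mem_ofPred_eq, map_mul, Complex.ofReal_mul]
    exact mul_mem he hf
  one_mem' := by
    rw [Set.mem_ofPred_eq, map_one, Complex.ofReal_one]
    exact one_mem _
  inv_mem' {e} he := by
    have h : rootHom hp k e⁻¹ = (rootHom hp k e)⁻¹ := by
      refine eq_inv_of_mul_eq_one_left ?_
      rw [← map_mul, inv_mul_cancel, map_one]
    rw [Set.mem_ofPred_eq, h, Complex.ofReal_inv]
    exact inv_mem he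

theorem mem_cycExponents (hp : ∀ i, (p i).Prime) {e : Multiplicative (Fin r → ℤ)} :
    e ∈ cycExponents hp k ↔ ((rootHom hp k e : ℝ) : ℂ) ∈ cycField k := Iff.rfl

theorem finrank_kummerField_eq_index (hp : ∀ i, (p i).Prime) [NeZero k] {Γ : Subgroup ℚˣ}
    (hΓ : Γ = Subgroup.closure {u : ℚˣ | ∃ i, (u : ℚ) = (p i : ℚ)}) :
    Module.finrank ℚ (kummerField Γ k) = k.totient * (cycExponents hp k).index := by
  have hk := NeZero.ne k
  have hζ : IsPrimitiveRoot (⟨_, exp_mem_cycField k⟩ : cycField k) k :=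
    IsPrimitiveRoot.coe_submonoidClass_iff.mp (Complex.isPrimitiveRoot_exp k hk)
  have h := finrank_adjoin_range_eq_index hk hζ
    (Complex.ofRealHom.toMonoidHom.comp (rootHom hp k)) (fun e => ?_) (cycExponents hp k)
    fun e => ?_
  · rw [kummerField_eq hp hΓ, ← h, ← finrank_cycField k]
    exact (Module.finrank_mul_finrank ℚ (cycField k) (IntermediateField.adjoin (cycField k)
      (Set.range (Complex.ofRealHom.toMonoidHom.comp (rootHom hp k))))).symm
  · refine ⟨algebraMap ℚ _ (∏ i, (p i : ℚ) ^ e.toAdd i), ?_⟩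
    have h2 := congrArg Complex.ofReal (rootHom_pow hp hk e.toAdd)
    rw [Complex.ofReal_pow] at h2
    refine h2.trans ?_
    rw [← IsScalarTower.algebraMap_apply]
    simp
  · rw [mem_cycExponents]
    exact ⟨fun he => ⟨⟨_, he⟩, rfl⟩, fun ⟨c, hc⟩ => by
      have := c.2
      rwa [show (c : ℂ) = _ from hc] at this⟩

/-- Reduction of exponent vectors modulo `k`. -/
def exponentMod (r k : ℕ) : Multiplicative (Fin r → ℤ) →* Multiplicative (Fin r → ZMod k) :=
  ((Int.castAddHom (ZMod k)).compLeft (Fin r)).toMultiplicative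

theorem exponentMod_ofAdd (e : Fin r → ℤ) :
    exponentMod r k (Multiplicative.ofAdd e) = Multiplicative.ofAdd fun i => (e i : ZMod k) := rfl

theorem exponentMod_surjective : Function.Surjective (exponentMod r k) := by
  intro e
  choose f hf using fun i => ZMod.intCast_surjective (e.toAdd i)
  exact ⟨Multiplicative.ofAdd f, congrArg Multiplicative.ofAdd (funext hf)⟩

theorem ker_exponentMod_le (hp : ∀ i, (p i).Prime) [NeZero k] :
    (exponentMod r k).ker ≤ cycExponents hp k := by
  intro e he
  obtain ⟨e, rfl⟩ := Multiplicative.ofAdd.surjective e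
  have h : ∀ i, ((e i : ℤ) : ZMod k) = 0 := fun i =>
    congrFun (Multiplicative.ofAdd.injective ((exponentMod_ofAdd e).symm.trans he)) i
  choose f hf using fun i => (ZMod.intCast_zmod_eq_zero_iff_dvd (e i) k).mp (h i)
  obtain rfl : e = fun i => k * f i := funext hf
  rw [mem_cycExponents, rootHom_mul_left hp (NeZero.ne k)]
  rw [Complex.ofReal_ratCast]
  exact (cycField k).algebraMap_mem _

/-- This is `[ℤ^r : H] · [H : kℤ^r] = k^r`. -/
theorem index_cycExponents_mul (hp : ∀ i, (p i).Prime) [NeZero k] :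
    (cycExponents hp k).index * Nat.card ((cycExponents hp k).map (exponentMod r k)) = k ^ r := by
  rw [← Subgroup.relIndex_ker, mul_comm, Subgroup.relIndex_mul_index (ker_exponentMod_le hp), Subgroup.index_ker,
    MonoidHom.range_eq_top.mpr exponentMod_surjective]
  simp

/-- The root has a rational square, so `∏ pᵢ^{2eᵢ}` is the `k`-th power of a rational; compare
valuations at each `pᵢ`. -/
theorem dvd_two_mul_of_mem_cycExponents (hp : ∀ i, (p i).Prime) (hinj : Function.Injective p)
    [NeZero k] {e : Fin r → ℤ} (he : Multiplicative.ofAdd e ∈ cycExponents hp k) (i : Fin r) :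
    (k : ℤ) ∣ 2 * e i := by
  obtain ⟨c, hc⟩ := exists_rat_eq_sq_of_mem_cycField ((mem_cycExponents hp).mp he) (NeZero.ne k)
    (rootHom_pow hp (NeZero.ne k) e)
  have h : c ^ k = (∏ i, (p i : ℚ) ^ e i) ^ 2 := by
    have : (c : ℝ) ^ k = ((∏ i, (p i : ℚ) ^ e i : ℚ) : ℝ) ^ 2 := by
      rw [← hc, ← rootHom_pow hp (NeZero.ne k), ← pow_mul, ← pow_mul, mul_comm]
    exact_mod_cast this
  have hv := congrArg (padicValRat (p i)) h
  have : Fact (p i).Prime := ⟨hp i⟩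
  rw [padicValRat.pow, padicValRat.pow, padicValRat_prod_zpow hp hinj] at hv
  exact ⟨_, hv.symm⟩

/-- The residue modulo `k` of the exponent vector of `(∏_{i ∈ S} pᵢ)^{k/2}`. -/
def halfIndicator (k : ℕ) (S : Finset (Fin r)) : Multiplicative (Fin r → ZMod k) :=
  exponentMod r k (Multiplicative.ofAdd fun i => if i ∈ S then ((k / 2 : ℕ) : ℤ) else 0)

theorem halfIndicator_injective (hk : k ≠ 0) (hk2 : Even k) :
    Function.Injective (halfIndicator (r := r) k) := by
  have hne : ((k / 2 : ℕ) : ZMod k) ≠ 0 := by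
    rw [Ne, ZMod.natCast_eq_zero_iff]
    intro h
    obtain ⟨m, rfl⟩ := hk2.two_dvd
    have := Nat.le_of_dvd (by omega) h
    omega
  intro S T h
  ext i
  have hi : ((if i ∈ S then ((k / 2 : ℕ) : ℤ) else 0 : ℤ) : ZMod k) =
      ((if i ∈ T then ((k / 2 : ℕ) : ℤ) else 0 : ℤ) : ZMod k) :=
    congrFun (Multiplicative.ofAdd.injective h) i
  split_ifs at hi with h1 h2 h2
  · exact iff_of_true h1 h2
  · rw [Int.cast_natCast, Int.cast_zero] at hi
    exact absurd hi hne
  · rw [Int.cast_natCast, Int.cast_zero] at hi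
    exact absurd hi.symm hne
  · exact iff_of_false h1 h2

theorem rootHom_halfIndicator_mem_iff (hp : ∀ i, (p i).Prime) (hinj : Function.Injective p)
    [NeZero k] (hk2 : Even k) {S : Finset (Fin r)} (hS : S.Nonempty) :
    (Multiplicative.ofAdd fun i => if i ∈ S then ((k / 2 : ℕ) : ℤ) else 0) ∈ cycExponents hp k ↔
      evenConductor (∏ i ∈ S, p i) ∣ k := by
  rw [evenConductor_dvd_iff (squarefree_prod_primes hp hinj S) ?_
    (x := (rootHom hp k (Multiplicative.ofAdd fun i => if i ∈ S then ((k / 2 : ℕ) : ℤ) else 0) :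
      ℝ)) ?_, mem_cycExponents, and_iff_right hk2]
  · intro h
    refine hS.ne_empty (prod_primes_injective hp hinj ?_)
    simpa using h
  · exact_mod_cast congrArg Complex.ofReal (rootHom_half_sq hp (NeZero.ne k) hk2 S)

theorem coe_map_cycExponents (hp : ∀ i, (p i).Prime) (hinj : Function.Injective p) [NeZero k] :
    ((cycExponents hp k).map (exponentMod r k) : Set (Multiplicative (Fin r → ZMod k))) =
      halfIndicator k '' {S | S = ∅ ∨ evenConductor (∏ i ∈ S, p i) ∣ k} := by
  have hempty : halfIndicator (r := r) k ∅ = 1 := by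
    simp only [halfIndicator, notMem_empty, if_false]
    exact map_one (exponentMod r k)
  apply Set.Subset.antisymm
  · rintro _ ⟨e, he, rfl⟩
    obtain ⟨e, rfl⟩ := Multiplicative.ofAdd.surjective e
    have hdvd := dvd_two_mul_of_mem_cycExponents hp hinj he
    rcases Nat.even_or_odd k with hk2 | hk2
    · obtain ⟨m, hm⟩ := hk2.two_dvd
      have hm' : k / 2 = m := by omega
      choose f hf using fun i => (show (m : ℤ) ∣ e i from by
        refine (mul_dvd_mul_iff_left (two_ne_zero (α := ℤ))).mp ?_
        have := hdvd i
        rwa [hm, Nat.cast_mul] at this)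
      -- With `k = 2m` and `e i = m * f i`, the residue of `e i` modulo `k` is `m` or `0` according
      -- to the parity of `f i`.
      let S : Finset (Fin r) := univ.filter fun i => Odd (f i)
      have heq : exponentMod r k (Multiplicative.ofAdd e) = halfIndicator k S := by
        rw [halfIndicator, exponentMod_ofAdd, exponentMod_ofAdd]
        congr 1
        ext i
        rw [ZMod.intCast_eq_intCast_iff_dvd_sub, hf i, hm']
        rcases Int.even_or_odd' (f i) with ⟨t, ht | ht⟩
        · rw [if_neg (by simp [S, ht]), hm]
          exact ⟨-t, by rw [ht]; push_cast; ring⟩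
        · rw [if_pos (by simp [S, ht]), hm]
          exact ⟨-t, by rw [ht]; push_cast; ring⟩
      refine ⟨S, ?_, heq.symm⟩
      rcases S.eq_empty_or_nonempty with h | h
      · exact Or.inl h
      · refine Or.inr ((rootHom_halfIndicator_mem_iff hp hinj hk2 h).mp ?_)
        have hker : (Multiplicative.ofAdd e)⁻¹ * (Multiplicative.ofAdd fun i =>
            if i ∈ S then ((k / 2 : ℕ) : ℤ) else 0) ∈ (exponentMod r k).ker := by
          rw [MonoidHom.mem_ker, map_mul, map_inv, heq, halfIndicator, inv_mul_cancel]
        have := (cycExponents hp k).mul_mem he (ker_exponentMod_le hp hker)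
        rwa [mul_inv_cancel_left] at this
    · refine ⟨∅, Or.inl rfl, ?_⟩
      rw [hempty, exponentMod_ofAdd]
      refine (congrArg Multiplicative.ofAdd (funext fun i => ?_) : _ =
        Multiplicative.ofAdd fun i => ((e i : ℤ) : ZMod k))
      symm
      refine (ZMod.intCast_zmod_eq_zero_iff_dvd (e i) k).mpr ?_
      refine IsCoprime.dvd_of_dvd_mul_left ?_ (hdvd i)
      exact Nat.isCoprime_iff_coprime.mpr (Nat.coprime_two_right.mpr hk2)
  · rintro _ ⟨S, hS, rfl⟩
    rcases S.eq_empty_or_nonempty with rfl | h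
    · rw [hempty]
      exact one_mem _
    · have hd := hS.resolve_left h.ne_empty
      have hk2 : Even k := by
        obtain ⟨x, hx⟩ := IsAlgClosed.exists_pow_nat_eq ((∏ i ∈ S, p i : ℕ) : ℂ) two_pos
        refine ((evenConductor_dvd_iff (squarefree_prod_primes hp hinj S) ?_ hx).mp hd).1
        intro h1
        refine h.ne_empty (prod_primes_injective hp hinj ?_)
        simpa using h1
      exact ⟨_, (rootHom_halfIndicator_mem_iff hp hinj hk2 h).mpr hd, rfl⟩

theorem card_map_cycExponents (hp : ∀ i, (p i).Prime) (hinj : Function.Injective p) [NeZero k] :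
    Nat.card ((cycExponents hp k).map (exponentMod r k)) =
      1 + #{η ∈ (∏ i, p i).divisors.erase 1 | evenConductor η ∣ k} := by
  change Nat.card ((cycExponents hp k).map (exponentMod r k) :
    Set (Multiplicative (Fin r → ZMod k))) = _
  have hP : ∏ i, p i ≠ 0 := prod_ne_zero_iff.mpr fun i _ => (hp i).ne_zero
  rw [coe_map_cycExponents hp hinj, Nat.card_coe_set_eq, Set.InjOn.ncard_image,
    ← Set.ncard_image_of_injective _ (prod_primes_injective hp hinj)]
  · rw [add_comm, ← card_insert_of_notMem (a := 1) (by simp), ← Set.ncard_coe_finset]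
    congr 1
    ext η
    rw [Set.mem_image, mem_coe, mem_insert, mem_filter, mem_erase, Nat.mem_divisors,
      dvd_prod_primes_iff hp hinj]
    constructor
    · rintro ⟨S, rfl | hS, rfl⟩
      · exact Or.inl prod_empty
      · refine or_iff_not_imp_left.mpr fun h1 => ⟨⟨h1, ⟨S, rfl⟩, hP⟩, hS⟩
    · rintro (rfl | ⟨⟨h1, ⟨S, rfl⟩, -⟩, hS⟩)
      · exact ⟨∅, Or.inl rfl, prod_empty⟩
      · exact ⟨S, Or.inr hS, rfl⟩
  · rcases Nat.even_or_odd k with hk2 | hk2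
    · exact (halfIndicator_injective (NeZero.ne k) hk2).injOn
    -- `halfIndicator` need not be injective for odd `k`, but then only `S = ∅` remains.
    · have h2 : ∀ S : Finset (Fin r), ¬ evenConductor (∏ i ∈ S, p i) ∣ k := by
        intro S h
        refine hk2.not_two_dvd_nat (dvd_trans ?_ h)
        rw [evenConductor]
        split_ifs
        · exact dvd_mul_right 2 _
        · exact ⟨2 * _, by ring⟩
      rintro S (hS | hS) T (hT | hT) -
      · rw [hS, hT]
      · exact absurd hT (h2 T)
      · exact absurd hS (h2 S)
      · exact absurd hS (h2 S)

theorem finrank_kummerField_mul (hp : ∀ i, (p i).Prime) (hinj : Function.Injective p) [NeZero k]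
    {Γ : Subgroup ℚˣ} (hΓ : Γ = Subgroup.closure {u : ℚˣ | ∃ i, (u : ℚ) = (p i : ℚ)}) :
    Module.finrank ℚ (kummerField Γ k) *
      (1 + #{η ∈ (∏ i, p i).divisors.erase 1 | evenConductor η ∣ k}) = k.totient * k ^ r := by
  rw [finrank_kummerField_eq_index hp hΓ, ← card_map_cycExponents hp hinj, mul_assoc,
    index_cycExponents_mul]

end Degree

/-! ### From the degree formula to the series -/

theorem jordanTotient_one (k : ℕ) : jordanTotient 1 k = k.totient := by
  have h := Nat.totient_eq_mul_prod_factors k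
  have h' : ((k.totient : ℚ) : ℝ) = (((k : ℚ) * ∏ p ∈ k.primeFactors, (1 - (p : ℚ)⁻¹) : ℚ) : ℝ) := by
    rw [h]
  rw [jordanTotient]
  push_cast at h'
  simp [h']

theorem evenConductor_ne_zero {η : ℕ} (h : η ≠ 0) : evenConductor η ≠ 0 := by
  rw [evenConductor]
  split_ifs <;> omega

theorem primeFactors_evenConductor {η : ℕ} (h : η ≠ 0) :
    (evenConductor η).primeFactors = (2 * η).primeFactors := by
  rw [evenConductor]
  split_ifs
  · rfl
  · rw [show 4 * η = 2 * (2 * η) by ring, Nat.primeFactors_mul (by norm_num) (by omega),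
      Finset.union_eq_right]
    exact Nat.primeFactors_mono (dvd_mul_right 2 η) (by omega)

theorem factorization_evenConductor_of_ne_two {η p : ℕ} (h : Squarefree η) (hp2 : p ≠ 2) :
    (evenConductor η).factorization p ≤ 1 := by
  have h1 := h.natFactorization_le_one p
  have hη := h.ne_zero
  have h2 : Nat.factorization 2 p = 0 := by
    rw [Nat.prime_two.factorization, Finsupp.single_apply, if_neg hp2.symm]
  have h4 : Nat.factorization 4 p = 0 := by
    rw [show 4 = 2 ^ 2 by norm_num, Nat.factorization_pow]
    simp [h2]
  rw [evenConductor]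
  split_ifs
  · rwa [Nat.factorization_mul (by norm_num) hη, Finsupp.add_apply, h2, zero_add]
  · rwa [Nat.factorization_mul (by norm_num) hη, Finsupp.add_apply, h4, zero_add]

/-- For `η ≡ 1 mod 4` the discriminant is odd, so `v₂(δ/2) = -1` and the maximum is 0; otherwise `δ
= 4η` and both sides are `1 + v₂(η)`. -/
theorem factorization_evenConductor_two {η : ℕ} (h : Squarefree η) (h1 : η ≠ 1) :
    (((evenConductor η).factorization 2 - 1 : ℕ) : ℤ) =
      max 0 (padicValRat 2 ((quadDiscr (η : ℚ) : ℚ) / 2)) := by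
  have hη := h.ne_zero
  have hηq : (η : ℚ) ≠ 0 := by exact_mod_cast hη
  rw [evenConductor, quadDiscr_eq h h1]
  split_ifs with h4
  · have h0 : η.factorization 2 = 0 := Nat.factorization_eq_zero_of_not_dvd (by omega)
    have h0' : padicValNat 2 η = 0 := padicValNat.eq_zero_of_not_dvd (by omega)
    rw [Nat.factorization_mul (by norm_num) hη, Finsupp.add_apply, h0,
      Nat.prime_two.factorization_self, Int.cast_natCast, padicValRat.div hηq (by norm_num),
      padicValRat.of_nat, h0', show (2 : ℚ) = ((2 : ℕ) : ℚ) by norm_num,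
      padicValRat.self one_lt_two]
    norm_num
  · rw [show 4 * η = 2 ^ 2 * η by ring, Nat.factorization_mul (by norm_num) hη,
      Finsupp.add_apply, Nat.Prime.factorization_pow Nat.prime_two, Finsupp.single_eq_same,
      show (((4 * (η : ℤ) : ℤ) : ℚ) / 2) = ((2 : ℕ) : ℚ) * (η : ℚ) by push_cast; ring,
      padicValRat.mul (by norm_num) hηq, padicValRat.self one_lt_two, padicValRat.of_nat,
      Nat.factorization_def η Nat.prime_two]
    omega

-- Only the prime 2 can divide the conductor more than once, so the prefactors reduce to a power of
-- 2.
open Finset in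
theorem prod_evenConductor {η : ℕ} (h : Squarefree η) (h1 : η ≠ 1) (r : ℕ) :
    ∏ p ∈ (evenConductor η).primeFactors,
        1 / (p : ℝ) ^ (((evenConductor η).factorization p - 1) * (r + 2)) *
          ((p : ℝ) / ((p : ℝ) + 1 - (p : ℝ) ^ (r + 2))) =
      1 / (2 : ℝ) ^ (max 0 (padicValRat 2 ((quadDiscr (η : ℚ) : ℚ) / 2)) * ((r : ℤ) + 2)) *
        ∏ l ∈ (2 * η).primeFactors, (l : ℝ) / ((l : ℝ) + 1 - (l : ℝ) ^ (r + 2)) := by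
  rw [prod_mul_distrib, primeFactors_evenConductor h.ne_zero]
  congr 1
  rw [prod_eq_single 2]
  · rw [← factorization_evenConductor_two h h1, ← zpow_natCast]
    push_cast
    rfl
  · intro p _ hp2
    have := factorization_evenConductor_of_ne_two h hp2
    rw [Nat.sub_eq_zero_of_le this]
    simp
  · intro h2
    exact absurd (Nat.mem_primeFactors.mpr ⟨Nat.prime_two, dvd_mul_right 2 η, by
      have := h.ne_zero
      omega⟩) h2

-- The totient in the numerator cancels the one in the degree, and the count in the degree formula
-- becomes the sum over `η`.
open Finset in
theorem densityTerm_eq {r : ℕ} {p : Fin r → ℕ} (hp : ∀ i, (p i).Prime)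
    (hinj : Function.Injective p) {k : ℕ} [NeZero k] {Γ : Subgroup ℚˣ}
    (hΓ : Γ = Subgroup.closure {u : ℚˣ | ∃ i, (u : ℚ) = (p i : ℚ)}) :
    densityTerm Γ 1 k = radicalTerm (r + 2) k + ∑ η ∈ (∏ i, p i).divisors.erase 1,
      if evenConductor η ∣ k then radicalTerm (r + 2) k else 0 := by
  have h := congrArg (Nat.cast (R := ℝ)) (finrank_kummerField_mul hp hinj (k := k) hΓ)
  rw [← sum_filter, sum_const, nsmul_eq_mul, densityTerm, jordanTotient_one, radicalTerm]
  push_cast at h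
  have hk : (k : ℝ) ≠ 0 := by exact_mod_cast NeZero.ne k
  have hφ : (k.totient : ℝ) ≠ 0 := by exact_mod_cast (Nat.totient_pos.mpr (NeZero.pos k)).ne'
  have hprod : (k.totient : ℝ) * (k : ℝ) ^ r ≠ 0 := mul_ne_zero hφ (pow_ne_zero _ hk)
  have hfin : (Module.finrank ℚ (kummerField Γ k) : ℝ) ≠ 0 := by
    rw [← h] at hprod
    exact left_ne_zero_of_mul hprod
  rw [pow_one, mul_one, ← one_add_mul, div_eq_iff (mul_ne_zero (pow_ne_zero _ hk) hfin)]
  field_simp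
  rw [pow_add]
  linear_combination (-(k : ℝ) ^ 2) * h

end

theorem corollary3 (r : ℕ) (hr : 1 ≤ r) (p : Fin r → ℕ) (hp : ∀ i, (p i).Prime)
    (hinj : Function.Injective p) (Γ : Subgroup ℚˣ)
    (hΓ : Γ = Subgroup.closure {u : ℚˣ | ∃ i, (u : ℚ) = (p i : ℚ)}) :
    Summable (fun k : ℕ+ => densityTerm Γ 1 k) ∧
    Multipliable (fun q : Nat.Primes => 1 - (q : ℝ) / ((q : ℝ) ^ (r + 2) - 1)) ∧
    densityConst Γ 1 =
      (∏' q : Nat.Primes, (1 - (q : ℝ) / ((q : ℝ) ^ (r + 2) - 1))) *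
        (1 + ∑ η ∈ (∏ i, p i).divisors.erase 1,
          1 / (2 : ℝ) ^ (max 0 (padicValRat 2 ((quadDiscr (η : ℚ) : ℚ) / 2)) * ((r : ℤ) + 2)) *
            ∏ l ∈ (2 * η).primeFactors, (l : ℝ) / ((l : ℝ) + 1 - (l : ℝ) ^ (r + 2))) := by
  have hs : 3 ≤ r + 2 := by omega
  set E := (∏ i, p i).divisors.erase 1
  have hsf : ∀ η ∈ E, Squarefree η ∧ η ≠ 1 := fun η hη => by
    rw [Finset.mem_erase, Nat.mem_divisors] at hη
    exact ⟨(squarefree_prod_primes hp hinj Finset.univ).squarefree_of_dvd hη.2.1, hη.1⟩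
  have hsum0 : Summable (radicalTerm (r + 2)) := (summable_norm_radicalTerm hs).of_norm
  have hsumη : ∀ D : ℕ, Summable fun k => if D ∣ k then radicalTerm (r + 2) k else 0 := fun D =>
    (hsum0.indicator {k | D ∣ k}).congr fun k => by simp [Set.indicator_apply]
  have hsum := hsum0.add (summable_sum fun η (_ : η ∈ E) => hsumη (evenConductor η))
  have hterm : ∀ k : ℕ+, densityTerm Γ 1 k = radicalTerm (r + 2) k +
      ∑ η ∈ E, if evenConductor η ∣ (k : ℕ) then radicalTerm (r + 2) k else 0 := fun k =>
    have : NeZero (k : ℕ) := ⟨k.ne_zero⟩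
    densityTerm_eq hp hinj hΓ
  refine ⟨?_, (hasProd_radicalTerm hs).multipliable, ?_⟩
  · simp_rw [hterm]
    exact hsum.comp_injective PNat.coe_injective
  · rw [densityConst]
    simp_rw [hterm]
    rw [PNat.coe_injective.tsum_eq (f := fun k : ℕ => radicalTerm (r + 2) k +
      ∑ η ∈ E, if evenConductor η ∣ k then radicalTerm (r + 2) k else 0) ?_,
      hsum0.tsum_add (summable_sum fun η _ => hsumη (evenConductor η)),
      Summable.tsum_finsetSum fun η _ => hsumη (evenConductor η), mul_add, mul_one, Finset.mul_sum,
      (hasProd_radicalTerm hs).tprod_eq]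
    · congr 1
      refine Finset.sum_congr rfl fun η hη => ?_
      obtain ⟨h, h1⟩ := hsf η hη
      rw [tsum_radicalTerm_ite_dvd hs (evenConductor_ne_zero h.ne_zero),
        (hasProd_radicalTerm hs).tprod_eq, prod_evenConductor h h1]
    -- Passing from positive integers to `ℕ` adds only `k = 0`, which every conductor divides but
    -- where `radicalTerm` vanishes.
    · intro k hk
      rcases Nat.eq_zero_or_pos k with rfl | hpos
      · simp [radicalTerm_zero (s := r + 2) (by omega)] at hk
      · exact ⟨⟨k, hpos⟩, rfl⟩
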